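/- Let $X$ be a nonempty compact metrizable space, $T:X\to X$ a homeomorphism, and $\mathcal U=\{U_1,\dots,U_k\}$ a finite open cover of $X$. Let $M_T(X)$ be the set of $T$-invariant Borel probability measures on $X$, and let $\mathcal A$ be the collection of all finite Borel partitions $\alpha$ of $X$ that refine $\mathcal U$, i.e. every atom of $\alpha$ is contained in some $U_i$. For a finite cover or partition $\mathcal V$ write $\mathcal V_0^{n-1}=\bigvee_{j=0}^{n-1}T^{-j}\mathcal V$, and put $$h_{\rm top}(\mathcal U)=\lim_{n\to\infty}\frac1n\log N(\mathcal U_0^{n-1}),\qquad h_\mu(\alpha)=\lim_{n\to\infty}\frac1n H_\mu(\alpha_0^{n-1}),$$ where $N(\mathcal V)$ is the minimal cardinality of a subcover of $\mathcal V$ and $H_\mu(\beta)=-\sum_{B\in\beta}\mu(B)\log\mu(B)$ (with $0\log 0=0$). Then: 1. for every $\mu\in M_T(X)$, $\inf_{\alpha\in\mathcal A}h_\mu(\alpha)\le h_{\rm top}(\mathcal U)$; 2. there exists an ergodic measure $\mu_0\in M_T(X)$ such that $h_{\mu_0}(\alpha)\ge h_{\rm top}(\mathcal U)$ for every $\alpha\in\mathcal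 A$; 3. $$\sup_{\mu\in M_T(X)}\ \inf_{\alpha\in\mathcal A}h_\mu(\alpha)\;=\;\inf_{\alpha\in\mathcal A}\ \sup_{\mu\in M_T(X)}h_\mu(\alpha)\;=\;h_{\rm top}(\mathcal U).$$ -/

import Mathlib

open Set Filter MeasureTheory

noncomputable section

namespace OpenCoverEntropy

variable {X : Type*}

/-- For a family `A = (A_i)` of sets indexed by an alphabet `ι` and a word `w` of length `n`,
the set `⋂_{j < n} T^{-j} A_{w_j}`. As `w` varies these sets are the members of
`A_0^{n-1} = A ∨ T^{-1} A ∨ ⋯ ∨ T^{-(n-1)} A`. -/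
def wordSet {ι : Type*} (T : X → X) (A : ι → Set X) {n : ℕ} (w : Fin n → ι) : Set X :=
  ⋂ j : Fin n, T^[(j : ℕ)] ⁻¹' A (w j)

/-- `N(U_0^{n-1})`: the minimal cardinality of a subcover of `U_0^{n-1}`. -/
def coverNumber {k : ℕ} (T : X → X) (U : Fin k → Set X) (n : ℕ) : ℕ :=
  sInf {m : ℕ | ∃ F : Finset (Fin n → Fin k),
    F.card = m ∧ (⋃ w ∈ F, wordSet T U w) = univ}

/-- The topological entropy of a finite cover, `h_top(U) = lim (1/n) log N(U_0^{n-1})`.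
The limit exists by subadditivity, so it is written as a `limsup`; the value `n = 0`
does not matter. -/
def topEntropy {k : ℕ} (T : X → X) (U : Fin k → Set X) : EReal :=
  limsup (fun n : ℕ => ((Real.log (coverNumber T U n) / n : ℝ) : EReal)) atTop

/-- A finite Borel (measurable) partition of `X`, as a finite indexed family of pairwise disjoint
measurable sets with union `X`. Empty atoms are allowed; they do not contribute to entropy. -/
structure FinPartition (X : Type*) [MeasurableSpace X] where
  size : ℕ
  atom : Fin size → Set X
  measurableSet_atom : ∀ i, MeasurableSet (atom i)
  disjoint_atom : ∀ i j, i ≠ j → Disjoint (atom i) (atom j)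
  iUnion_atom : (⋃ i, atom i) = univ

/-- `H_μ(α_0^{n-1}) = -∑_A μ(A) log μ(A)`, the Shannon entropy of the partition
`α ∨ T^{-1} α ∨ ⋯ ∨ T^{-(n-1)} α`. -/
def shannonEntropy [MeasurableSpace X] (T : X → X) (μ : Measure X) (α : FinPartition X)
    (n : ℕ) : ℝ :=
  ∑ w : Fin n → Fin α.size, Real.negMulLog (μ.real (wordSet T α.atom w))

/-- The measure entropy of a finite partition, `h_μ(α) = lim (1/n) H_μ(α_0^{n-1})`.
For an invariant probability measure the limit exists by subadditivity, so it is written as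
a `limsup`; the value `n = 0` does not matter. -/
def measureEntropy [MeasurableSpace X] (T : X → X) (μ : Measure X) (α : FinPartition X) : EReal :=
  limsup (fun n : ℕ => ((shannonEntropy T μ α n / n : ℝ) : EReal)) atTop

/-- `M_T(X)`: the `T`-invariant probability measures on `X`. -/
def invariantMeasures [MeasurableSpace X] (T : X → X) : Set (ProbabilityMeasure X) :=
  {μ | MeasurePreserving T (μ : Measure X) (μ : Measure X)}

/-- The finite measurable partitions that refine `U`: every atom lies in some `U i`. -/
def refiningPartitions [MeasurableSpace X] {k : ℕ} (U : Fin k → Set X) : Set (FinPartition X) :=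
  {α | ∀ a, ∃ i, α.atom a ⊆ U i}

/-- `sup_{μ ∈ M_T(X)} inf_{α refining U} h_μ(α)`. -/
def supInfEntropy [MeasurableSpace X] {k : ℕ} (T : X → X) (U : Fin k → Set X) : EReal :=
  ⨆ μ ∈ invariantMeasures T, ⨅ α ∈ refiningPartitions U, measureEntropy T (μ : Measure X) α

/-- `inf_{α refining U} sup_{μ ∈ M_T(X)} h_μ(α)`. -/
def infSupEntropy [MeasurableSpace X] {k : ℕ} (T : X → X) (U : Fin k → Set X) : EReal :=
  ⨅ α ∈ refiningPartitions U, ⨆ μ ∈ invariantMeasures T, measureEntropy T (μ : Measure X) α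

end OpenCoverEntropy

end

/-! Write h for `topEntropy T U`. The theorem reduces to two estimates, since sup inf ≤ inf sup
always holds.

Upper estimate: for each r' > h, one Borel partition refining U has at most C·exp(n r') names of
length n, so its entropy is at most r' for all probability measures at once
(`exists_refining_partition_entropy_le`). Making U disjoint arbitrarily gives no such control.
Instead a Borel marker set cuts orbits into blocks of length g in [N, 2N), and each block is
labelled by a word from a minimal subcover of U_0^{g-1}. For large N the freedom in the block
lengths costs less than r' - h. Points fixed by T^{N!} carry no markers, but have boundedly many
names (`exists_label_of_marker`, `card_itineraries`).

Lower estimate: in a zero-dimensional system the entropy of a clopen partition is an infimum of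
continuous functions of the measure. For finitely many clopen partitions refining the cover, a
greedily chosen finite set is separated by all of them and has nearly N(U_0^{n-1}) points up to a
constant factor; orbit averages of its uniform measure accumulate at an invariant measure of large
entropy (Misiurewicz's argument, `exists_invariant_entropy_ge`). Compactness treats all clopen
partitions together, and `exists_clopenPartition_entropy_le` passes to Borel ones.

The resulting set of measures is compact, and conditioning on invariant sets preserves it, by the
upper estimate (`topEntropy_le_measureEntropy_cond`). A maximizer on it of a strictly convex
continuous functional is therefore ergodic, without ergodic decomposition. A general system is a
factor of a zero-dimensional one, and the measure is pushed down. -/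

noncomputable section

namespace OpenCoverEntropy

set_option linter.unusedSectionVars false

open ProbabilityTheory

/-! ### Shannon entropy of finite-valued functions -/

section Entropy

variable {Ω : Type*} [MeasurableSpace Ω]

/-- Shannon entropy of a finite-valued function under `μ`. -/
def entropy (μ : Measure Ω) {ι : Type*} [Fintype ι] (f : Ω → ι) : ℝ :=
  ∑ i, Real.negMulLog (μ.real (f ⁻¹' {i}))

variable {ι κ : Type*} [Fintype ι] [MeasurableSpace ι] [MeasurableSingletonClass ι]
  [Fintype κ] [MeasurableSpace κ] [MeasurableSingletonClass κ]

lemma measureReal_preimage_eq_sum (μ : Measure Ω) [IsProbabilityMeasure μ] {f : Ω → ι}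
    (hf : Measurable f) (s : Finset ι) :
    μ.real (f ⁻¹' s) = ∑ i ∈ s, μ.real (f ⁻¹' {i}) := by
  rw [← measureReal_biUnion_finset]
  · congr 1; ext x; simp
  · intro i _ j _ hij
    exact Disjoint.preimage _ (by simpa using hij)
  · intro i _; exact hf (measurableSet_singleton i)

lemma sum_measureReal_preimage (μ : Measure Ω) [IsProbabilityMeasure μ] {f : Ω → ι}
    (hf : Measurable f) : ∑ i, μ.real (f ⁻¹' {i}) = 1 := by
  rw [← measureReal_preimage_eq_sum μ hf]; simp

lemma entropy_nonneg (μ : Measure Ω) [IsProbabilityMeasure μ] (f : Ω → ι) : 0 ≤ entropy μ f :=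
  Finset.sum_nonneg fun _ _ => Real.negMulLog_nonneg measureReal_nonneg measureReal_le_one

lemma entropy_le_log_card (μ : Measure Ω) [IsProbabilityMeasure μ] {f : Ω → ι}
    (hf : Measurable f) (F : Finset ι) (hF : ∀ x, f x ∈ F) :
    entropy μ f ≤ Real.log F.card := by
  have hne : Nonempty Ω := nonempty_of_isProbabilityMeasure μ
  obtain ⟨x⟩ := hne
  have hpos : (0 : ℝ) < F.card := by exact_mod_cast Finset.card_pos.2 ⟨_, hF x⟩
  have hout : ∀ i ∉ F, f ⁻¹' {i} = ∅ := by
    intro i hi; ext y; simp only [mem_preimage, mem_singleton_iff, mem_empty_iff_false, iff_false]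
    rintro rfl; exact hi (hF y)
  have h1 : entropy μ f = ∑ i ∈ F, Real.negMulLog (μ.real (f ⁻¹' {i})) := by
    refine (Finset.sum_subset (Finset.subset_univ F) ?_).symm
    intro i _ hi; simp [hout i hi]
  have h2 : ∑ i ∈ F, μ.real (f ⁻¹' {i}) = 1 := by
    rw [← measureReal_preimage_eq_sum μ hf]
    have : f ⁻¹' (F : Set ι) = univ := by ext y; simpa using hF y
    simp [this]
  have h3 := Real.concaveOn_negMulLog.le_map_sum (t := F) (w := fun _ => (F.card : ℝ)⁻¹)
    (p := fun i => μ.real (f ⁻¹' {i})) (fun _ _ => by positivity)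
    (by simp [hpos.ne']) (fun _ _ => measureReal_nonneg)
  simp only [smul_eq_mul, ← Finset.mul_sum, h2, mul_one] at h3
  rw [← h1, Real.negMulLog, Real.log_inv] at h3
  have := mul_le_mul_of_nonneg_left h3 hpos.le
  rw [← mul_assoc, mul_inv_cancel₀ hpos.ne'] at this
  calc _ = 1 * entropy μ f := (one_mul _).symm
    _ ≤ _ := this
    _ = _ := by field_simp

/-- Gibbs' inequality from log x ≤ x - 1. The correction q - p is kept because it cancels after
summing over two probability vectors. -/
lemma negMulLog_le_cross {p q : ℝ} (hp : 0 ≤ p) (hq : 0 ≤ q) (h : q = 0 → p = 0) :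
    Real.negMulLog p ≤ -p * Real.log q + (q - p) := by
  rcases hp.eq_or_lt with rfl | hp'
  · simpa using hq
  have hq' : 0 < q := lt_of_le_of_ne hq fun h' => hp'.ne' (h h'.symm)
  have := Real.log_le_sub_one_of_pos (div_pos hq' hp')
  rw [Real.log_div hq'.ne' hp'.ne'] at this
  have h2 := mul_le_mul_of_nonneg_left this hp
  have h3 : p * (q / p - 1) = q - p := by field_simp
  rw [Real.negMulLog]; nlinarith

lemma entropy_prodMk_le (μ : Measure Ω) [IsProbabilityMeasure μ] {f : Ω → ι} {g : Ω → κ}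
    (hf : Measurable f) (hg : Measurable g) :
    entropy μ (fun x => (f x, g x)) ≤ entropy μ f + entropy μ g := by
  set a : ι → ℝ := fun i => μ.real (f ⁻¹' {i})
  set b : κ → ℝ := fun j => μ.real (g ⁻¹' {j})
  set p : ι → κ → ℝ := fun i j => μ.real ((fun x => (f x, g x)) ⁻¹' {(i, j)})
  have hpa : ∀ i j, p i j ≤ a i := fun i j => measureReal_mono (by intro x; simp; tauto)
  have hpb : ∀ i j, p i j ≤ b j := fun i j => measureReal_mono (by intro x; simp)
  have hp0 : ∀ i j, 0 ≤ p i j := fun i j => measureReal_nonneg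
  have ha0 : ∀ i, 0 ≤ a i := fun i => measureReal_nonneg
  have hb0 : ∀ i, 0 ≤ b i := fun i => measureReal_nonneg
  have hsa : ∀ i, ∑ j, p i j = a i := by
    intro i
    have : a i = ∑ j, μ.real ((f ⁻¹' {i}) ∩ (g ⁻¹' {j})) := by
      rw [← measureReal_biUnion_finset]
      · simp only [a]; congr 1; ext x; simp
      · intro j _ j' _ hjj
        exact (Disjoint.preimage g (by simpa using hjj)).mono inter_subset_right inter_subset_right
      · intro j _; exact (hf (measurableSet_singleton i)).inter (hg (measurableSet_singleton j))
    rw [this]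
    refine Finset.sum_congr rfl fun j _ => ?_
    simp only [p]; congr 1; ext x; simp
  have hsb : ∀ j, ∑ i, p i j = b j := by
    intro j
    have : b j = ∑ i, μ.real ((f ⁻¹' {i}) ∩ (g ⁻¹' {j})) := by
      rw [← measureReal_biUnion_finset]
      · simp only [b]; congr 1; ext x; simp
      · intro i _ i' _ hii
        exact (Disjoint.preimage f (by simpa using hii)).mono inter_subset_left inter_subset_left
      · intro i _; exact (hf (measurableSet_singleton i)).inter (hg (measurableSet_singleton j))
    rw [this]
    refine Finset.sum_congr rfl fun i _ => ?_
    simp only [p]; congr 1; ext x; simp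
  have hA : ∑ i, a i = 1 := sum_measureReal_preimage μ hf
  have hB : ∑ j, b j = 1 := sum_measureReal_preimage μ hg
  have key : ∀ i j, Real.negMulLog (p i j) ≤
      -p i j * Real.log (a i) + -p i j * Real.log (b j) + (a i * b j - p i j) := by
    intro i j
    have hz : a i * b j = 0 → p i j = 0 := by
      intro h
      rcases mul_eq_zero.1 h with h | h
      · exact le_antisymm (h ▸ hpa i j) (hp0 i j)
      · exact le_antisymm (h ▸ hpb i j) (hp0 i j)
    have := negMulLog_le_cross (hp0 i j) (mul_nonneg (ha0 i) (hb0 j)) hz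
    rcases eq_or_ne (p i j) 0 with h0 | h0
    · simpa [h0] using this
    · have hai : a i ≠ 0 := fun h => h0 (hz (by simp [h]))
      have hbj : b j ≠ 0 := fun h => h0 (hz (by simp [h]))
      rw [Real.log_mul hai hbj] at this
      linarith
  calc entropy μ (fun x => (f x, g x)) = ∑ i, ∑ j, Real.negMulLog (p i j) := by
        rw [entropy, Fintype.sum_prod_type]
    _ ≤ ∑ i, ∑ j, (-p i j * Real.log (a i) + -p i j * Real.log (b j) + (a i * b j - p i j)) :=
        Finset.sum_le_sum fun i _ => Finset.sum_le_sum fun j _ => key i j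
    _ = ∑ i, ∑ j, -p i j * Real.log (a i) + ∑ j, ∑ i, -p i j * Real.log (b j)
          + (∑ i, ∑ j, a i * b j - ∑ i, ∑ j, p i j) := by
        simp only [Finset.sum_add_distrib, Finset.sum_sub_distrib]
        rw [Finset.sum_comm (f := fun i j => -p i j * Real.log (b j))]
    _ = _ := by
        have e1 : ∀ i, ∑ j, -p i j * Real.log (a i) = Real.negMulLog (a i) := by
          intro i; rw [← Finset.sum_mul, Finset.sum_neg_distrib, hsa]; rfl
        have e2 : ∀ j, ∑ i, -p i j * Real.log (b j) = Real.negMulLog (b j) := by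
          intro j; rw [← Finset.sum_mul, Finset.sum_neg_distrib, hsb]; rfl
        simp only [e1, e2, hsa, ← Finset.mul_sum, hB, hA, mul_one, sub_self, add_zero]
        rfl

lemma negMulLog_sum_le {α : Type*} (s : Finset α) (x : α → ℝ) (hx : ∀ i ∈ s, 0 ≤ x i) :
    Real.negMulLog (∑ i ∈ s, x i) ≤ ∑ i ∈ s, Real.negMulLog (x i) := by
  rw [Real.negMulLog, ← Finset.sum_neg_distrib, Finset.sum_mul]
  refine Finset.sum_le_sum fun i hi => ?_
  rcases (hx i hi).eq_or_lt with h | h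
  · simp [← h]
  · have := Real.log_le_log h (Finset.single_le_sum hx hi)
    rw [Real.negMulLog]; nlinarith

lemma entropy_comp_le (μ : Measure Ω) [IsProbabilityMeasure μ] {f : Ω → ι}
    (hf : Measurable f) (φ : ι → κ) : entropy μ (fun x => φ (f x)) ≤ entropy μ f := by
  classical
  have h1 : ∀ j, μ.real ((fun x => φ (f x)) ⁻¹' {j}) =
      ∑ i ∈ Finset.univ.filter (fun i => φ i = j), μ.real (f ⁻¹' {i}) := by
    intro j; rw [← measureReal_preimage_eq_sum μ hf]; congr 1; ext x; simp
  calc entropy μ (fun x => φ (f x))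
      ≤ ∑ j, ∑ i ∈ Finset.univ.filter (fun i => φ i = j),
          Real.negMulLog (μ.real (f ⁻¹' {i})) := by
        refine Finset.sum_le_sum fun j _ => ?_
        rw [h1]; exact negMulLog_sum_le _ _ fun _ _ => measureReal_nonneg
    _ = entropy μ f := by
        rw [entropy, ← Finset.sum_fiberwise (s := Finset.univ) (g := φ)]

lemma entropy_le_of_factor (μ : Measure Ω) [IsProbabilityMeasure μ] {f : Ω → ι} {g : Ω → κ}
    (hf : Measurable f) (φ : ι → κ) (h : ∀ x, g x = φ (f x)) : entropy μ g ≤ entropy μ f := by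
  rw [funext h]; exact entropy_comp_le μ hf φ

/-- The information -log μ(atom) is at least log M on every atom of positive mass. -/
lemma log_le_entropy (μ : Measure Ω) [IsProbabilityMeasure μ] {f : Ω → ι} (hf : Measurable f)
    {M : ℝ} (h : ∀ i, μ.real (f ⁻¹' {i}) ≤ M⁻¹) : Real.log M ≤ entropy μ f := by
  calc Real.log M = ∑ i, μ.real (f ⁻¹' {i}) * Real.log M := by
        rw [← Finset.sum_mul, sum_measureReal_preimage μ hf, one_mul]
    _ ≤ entropy μ f := by
        refine Finset.sum_le_sum fun i _ => ?_
        rcases (measureReal_nonneg (μ := μ) (s := f ⁻¹' {i})).eq_or_lt with h0 | h0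
        · simp [← h0]
        · have := Real.log_le_log h0 (h i)
          rw [Real.log_inv] at this
          rw [Real.negMulLog]; nlinarith

/-- Concavity of entropy in the measure, by Jensen on each atom. -/
lemma average_entropy_le {n : ℕ} (hn : n ≠ 0) (ν : ℕ → Measure Ω) (μ : Measure Ω) (f : Ω → ι)
    (hμ : ∀ i, μ.real (f ⁻¹' {i}) = (n : ℝ)⁻¹ * ∑ j ∈ Finset.range n, (ν j).real (f ⁻¹' {i})) :
    ∑ j ∈ Finset.range n, entropy (ν j) f ≤ n * entropy μ f := by
  have hn' : (0 : ℝ) < n := by positivity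
  simp only [entropy]
  rw [Finset.sum_comm, Finset.mul_sum]
  refine Finset.sum_le_sum fun i _ => ?_
  have h3 := Real.concaveOn_negMulLog.le_map_sum (t := Finset.range n) (w := fun _ => (n : ℝ)⁻¹)
    (p := fun j => (ν j).real (f ⁻¹' {i})) (fun _ _ => by positivity)
    (by simp [hn'.ne']) (fun _ _ => measureReal_nonneg)
  simp only [smul_eq_mul, ← Finset.mul_sum] at h3
  rw [← hμ] at h3
  calc _ = n * ((n : ℝ)⁻¹ * ∑ j ∈ Finset.range n, Real.negMulLog ((ν j).real (f ⁻¹' {i}))) := by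
        field_simp
    _ ≤ _ := by gcongr

lemma entropy_map (μ : Measure Ω) {Ω' : Type*} [MeasurableSpace Ω'] {S : Ω → Ω'}
    (hS : Measurable S) {f : Ω' → ι} (hf : Measurable f) :
    entropy (μ.map S) f = entropy μ (fun x => f (S x)) := by
  refine Finset.sum_congr rfl fun i _ => ?_
  rw [measureReal_def, Measure.map_apply hS (hf (measurableSet_singleton i))]; rfl

end Entropy

/-! ### Itineraries and block decomposition -/

section Names

variable {X : Type*} {ι : Type*}

/-- The itinerary of length `n` of a point with respect to a labelling `c`. -/
def itinerary (T : X → X) (c : X → ι) (n : ℕ) (x : X) : Fin n → ι := fun j => c (T^[j] x)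

lemma measurable_itinerary [MeasurableSpace X] [MeasurableSpace ι] {T : X → X} {c : X → ι}
    (hT : Measurable T) (hc : Measurable c) (n : ℕ) : Measurable (itinerary T c n) :=
  measurable_pi_lambda _ fun j => hc.comp (hT.iterate j)

variable [MeasurableSpace X] 

/-- The offset `i` stays in the statement because ν is not assumed invariant; the orbit averages
below need this form. -/
lemma itinerary_subadd {κ : Type*} [Fintype κ] [MeasurableSpace κ] [MeasurableSingletonClass κ]
    (ν : Measure X) [IsProbabilityMeasure ν] {T : X → X} {c : X → κ}
    (hT : Measurable T) (hc : Measurable c) (i m n : ℕ) :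
    entropy ν (fun x => itinerary T c (m + n) (T^[i] x)) ≤
      entropy ν (fun x => itinerary T c m (T^[i] x)) +
      entropy ν (fun x => itinerary T c n (T^[i + m] x)) := by
  have h1 : Measurable (fun x => itinerary T c m (T^[i] x)) :=
    (measurable_itinerary hT hc m).comp (hT.iterate i)
  have h2 : Measurable (fun x => itinerary T c n (T^[i + m] x)) :=
    (measurable_itinerary hT hc n).comp (hT.iterate _)
  refine (entropy_le_of_factor ν (h1.prodMk h2) (fun p => Fin.append p.1 p.2) ?_).trans
    (entropy_prodMk_le ν h1 h2)
  intro x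
  funext j
  refine Fin.addCases (fun j => ?_) (fun j => ?_) j
  · simp [itinerary]
  · simp only [itinerary, Fin.append_right, Fin.val_natAdd, ← Function.iterate_add_apply]
    congr 2; omega

lemma itinerary_mono {κ : Type*} [Fintype κ] [MeasurableSpace κ] [MeasurableSingletonClass κ]
    (ν : Measure X) [IsProbabilityMeasure ν] {T : X → X} {c : X → κ}
    (hT : Measurable T) (hc : Measurable c) (i : ℕ) {m n : ℕ} (h : m ≤ n) :
    entropy ν (fun x => itinerary T c m (T^[i] x)) ≤
      entropy ν (fun x => itinerary T c n (T^[i] x)) :=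
  entropy_le_of_factor ν ((measurable_itinerary hT hc n).comp (hT.iterate i))
    (fun w j => w (Fin.castLE h j)) fun _ => rfl

lemma itinerary_entropy_le {κ : Type*} [Fintype κ] [MeasurableSpace κ] [MeasurableSingletonClass κ]
    (ν : Measure X) [IsProbabilityMeasure ν] {T : X → X} {c : X → κ}
    (hT : Measurable T) (hc : Measurable c) (i n : ℕ) :
    entropy ν (fun x => itinerary T c n (T^[i] x)) ≤ n * Real.log (Fintype.card κ) := by
  refine (entropy_le_log_card ν ((measurable_itinerary hT hc n).comp (hT.iterate i)) Finset.univ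
    (fun _ => Finset.mem_univ _)).trans ?_
  simp

/-- Averaged block decomposition for a subadditive monotone array. -/
lemma block_average_bound (a : ℕ → ℕ → ℝ) (C : ℝ) (h0 : ∀ i l, 0 ≤ a i l)
    (hC : ∀ i l, a i l ≤ l * C) (hsub : ∀ i m n, a i (m + n) ≤ a i m + a (i + m) n)
    (hmono : ∀ i m n, m ≤ n → a i m ≤ a i n) (n q : ℕ) (hq : q ≠ 0) (hC0 : 0 ≤ C) :
    q * a 0 n ≤ ∑ i ∈ Finset.range n, a i q + 2 * q ^ 2 * C := by
  set M := n / q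
  have hMn : M * q ≤ n := Nat.div_mul_le_self n q
  have hnM : n < M * q + q := by
    have := Nat.lt_div_mul_add (a := n) (Nat.pos_of_ne_zero hq); simpa using this
  have hblock : ∀ j M, a j (M * q) ≤ ∑ t ∈ Finset.range M, a (j + t * q) q := by
    intro j M
    induction M with
    | zero => simpa using hC j 0
    | succ M ih =>
      rw [Finset.sum_range_succ, Nat.succ_mul]
      exact (hsub _ _ _).trans (by gcongr)
  -- Cut at j, j + q, j + 2q, ...: the initial piece of length j and the last one of length q cost
  -- at most q * C each.
  have hj : ∀ j ∈ Finset.range q, a 0 n ≤ ∑ t ∈ Finset.range M, a (j + t * q) q + 2 * q * C := by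
    intro j hj
    have hjq : (j : ℝ) ≤ q := by exact_mod_cast (Finset.mem_range.1 hj).le
    have h1 := hmono 0 n (j + (M * q + q)) (by omega)
    have h2 := hsub 0 j (M * q + q)
    have h3 := hsub (0 + j) (M * q) q
    have h4 := hblock j M
    have h5 := hC 0 j
    have h6 := hC (0 + j + M * q) q
    rw [zero_add] at h2 h3 h6
    nlinarith
  -- Every i < M * q is j + t * q for exactly one pair, so summing over the q offsets uses each
  -- starting time once.
  have hsum : ∀ M, ∑ j ∈ Finset.range q, ∑ t ∈ Finset.range M, a (j + t * q) q
      = ∑ i ∈ Finset.range (M * q), a i q := by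
    intro M
    induction M with
    | zero => simp
    | succ M ih =>
      simp only [Finset.sum_range_succ, Finset.sum_add_distrib, Nat.succ_mul, Finset.sum_range_add,
        ih]
      congr 1
      exact Finset.sum_congr rfl fun j _ => by rw [add_comm]
  calc (q : ℝ) * a 0 n = ∑ j ∈ Finset.range q, a 0 n := by simp
    _ ≤ ∑ j ∈ Finset.range q, (∑ t ∈ Finset.range M, a (j + t * q) q + 2 * q * C) :=
        Finset.sum_le_sum hj
    _ = ∑ i ∈ Finset.range (M * q), a i q + 2 * q ^ 2 * C := by
        rw [Finset.sum_add_distrib, hsum]; simp; ring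
    _ ≤ _ := by
        gcongr
        exact fun i _ _ => h0 i q

end Names

lemma mem_wordSet {X ι : Type*} {T : X → X} {A : ι → Set X} {n : ℕ} {w : Fin n → ι} {x : X} :
    x ∈ wordSet T A w ↔ ∀ j : Fin n, T^[j] x ∈ A (w j) := by
  simp [wordSet]

/-! ### Partitions as labelling functions -/

section Labels

variable {X : Type*} [MeasurableSpace X]

/-- The index of the atom of `α` containing a point. -/
def FinPartition.label (α : FinPartition X) (x : X) : Fin α.size :=
  (mem_iUnion.1 (α.iUnion_atom ▸ mem_univ x : x ∈ ⋃ i, α.atom i)).choose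

lemma FinPartition.mem_atom_label (α : FinPartition X) (x : X) : x ∈ α.atom (α.label x) :=
  (mem_iUnion.1 (α.iUnion_atom ▸ mem_univ x : x ∈ ⋃ i, α.atom i)).choose_spec

lemma FinPartition.label_eq_iff (α : FinPartition X) {x : X} {i : Fin α.size} :
    α.label x = i ↔ x ∈ α.atom i := by
  constructor
  · rintro rfl; exact α.mem_atom_label x
  · intro h
    by_contra hne
    exact disjoint_left.1 (α.disjoint_atom _ _ hne) (α.mem_atom_label x) h

lemma FinPartition.preimage_label (α : FinPartition X) (i : Fin α.size) :
    α.label ⁻¹' {i} = α.atom i := by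
  ext x; simp [α.label_eq_iff]

lemma FinPartition.measurable_label (α : FinPartition X) : Measurable α.label :=
  measurable_to_countable' fun i => by
    rw [α.preimage_label]; exact α.measurableSet_atom i

/-- The partition into the fibres of a measurable function with values in `Fin s`. -/
def FinPartition.ofFun {s : ℕ} (c : X → Fin s) (hc : Measurable c) : FinPartition X where
  size := s
  atom i := c ⁻¹' {i}
  measurableSet_atom i := hc (measurableSet_singleton i)
  disjoint_atom i j hij := Disjoint.preimage c (by simpa using hij)
  iUnion_atom := by ext x; simp

lemma FinPartition.label_ofFun {s : ℕ} (c : X → Fin s) (hc : Measurable c) :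
    (FinPartition.ofFun c hc).label = c := by
  funext x
  exact (FinPartition.label_eq_iff (FinPartition.ofFun c hc)).2 rfl

lemma FinPartition.label_spec {α : FinPartition X} {k : ℕ} {U : Fin k → Set X}
    (hα : α ∈ refiningPartitions U) : ∃ f : Fin α.size → Fin k, ∀ x, x ∈ U (f (α.label x)) := by
  choose f hf using hα
  exact ⟨f, fun x => hf _ (α.mem_atom_label x)⟩

lemma wordSet_atom (T : X → X) (α : FinPartition X) {n : ℕ} (w : Fin n → Fin α.size) :
    wordSet T α.atom w = itinerary T α.label n ⁻¹' {w} := by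
  ext x
  simp [wordSet, itinerary, funext_iff, α.label_eq_iff]

lemma shannonEntropy_eq (T : X → X) (μ : Measure X) (α : FinPartition X) (n : ℕ) :
    shannonEntropy T μ α n = entropy μ (itinerary T α.label n) := by
  simp only [shannonEntropy, entropy, wordSet_atom]

lemma shannonEntropy_ofFun (T : X → X) (μ : Measure X) {s : ℕ} (c : X → Fin s)
    (hc : Measurable c) (n : ℕ) :
    shannonEntropy T μ (FinPartition.ofFun c hc) n = entropy μ (itinerary T c n) := by
  rw [shannonEntropy_eq, FinPartition.label_ofFun]; rfl

end Labels

/-! ### Minimal subcovers -/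

section CoverNumber

variable {X : Type*} {k : ℕ} {T : X → X} {U : Fin k → Set X}

lemma exists_card_eq_coverNumber (hU : (⋃ i, U i) = univ) (n : ℕ) :
    ∃ F : Finset (Fin n → Fin k), F.card = coverNumber T U n ∧ (⋃ w ∈ F, wordSet T U w) = univ := by
  have : (coverNumber T U n) ∈ {m : ℕ | ∃ F : Finset (Fin n → Fin k),
    F.card = m ∧ (⋃ w ∈ F, wordSet T U w) = univ} := by
    refine Nat.sInf_mem ⟨_, Finset.univ, rfl, ?_⟩
    refine eq_univ_of_forall fun x => ?_
    have h : ∀ j : Fin n, ∃ i, T^[j] x ∈ U i := fun j =>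
      mem_iUnion.1 (hU ▸ mem_univ _)
    choose w hw using h
    simp only [Finset.mem_univ, iUnion_true, mem_iUnion]
    exact ⟨w, by simpa [wordSet] using hw⟩
  exact this

lemma coverNumber_le_card {n : ℕ} (F : Finset (Fin n → Fin k))
    (hF : (⋃ w ∈ F, wordSet T U w) = univ) : coverNumber T U n ≤ F.card :=
  Nat.sInf_le ⟨F, rfl, hF⟩

lemma coverNumber_pos [Nonempty X] (hU : (⋃ i, U i) = univ) (n : ℕ) : 0 < coverNumber T U n := by
  obtain ⟨F, hF, hc⟩ := exists_card_eq_coverNumber (T := T) hU n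
  rw [← hF, Finset.card_pos]
  by_contra h
  rw [Finset.not_nonempty_iff_eq_empty] at h
  simp only [h, Finset.notMem_empty, iUnion_of_empty, iUnion_empty] at hc
  exact empty_ne_univ hc

lemma log_coverNumber_nonneg (n : ℕ) : 0 ≤ Real.log (coverNumber T U n) :=
  Real.log_natCast_nonneg _

lemma topEntropy_nonneg : 0 ≤ topEntropy T U := by
  refine le_limsup_of_frequently_le (Frequently.of_forall fun n => ?_) (by isBoundedDefault)
  exact_mod_cast div_nonneg (log_coverNumber_nonneg n) (Nat.cast_nonneg n)

end CoverNumber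

lemma exists_measurable_selection {X ι : Type*} [MeasurableSpace X] [MeasurableSpace ι]
    [Nonempty ι] (V : ι → Set X) (hV : ∀ i, MeasurableSet (V i)) (W : Finset ι) :
    ∃ φ : X → ι, Measurable φ ∧ ∀ x ∈ ⋃ i ∈ W, V i, φ x ∈ W ∧ x ∈ V (φ x) := by
  classical
  induction W using Finset.induction_on with
  | empty => exact ⟨fun _ => Classical.arbitrary ι, measurable_const, by simp⟩
  | insert a s ha ih =>
    obtain ⟨φ, hφ, h⟩ := ih
    refine ⟨(V a).piecewise (fun _ => a) φ, Measurable.piecewise (hV a) measurable_const hφ, ?_⟩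
    intro x hx
    by_cases hxa : x ∈ V a
    · simp [hxa]
    · have hx' : x ∈ ⋃ i ∈ s, V i := by simpa [hxa] using hx
      simp [hxa, h x hx']

/-! ### Borel marker sets -/

section Marker

variable {X : Type*} [TopologicalSpace X] [T2Space X] [SecondCountableTopology X]
  [MeasurableSpace X] [BorelSpace X]

lemma exists_open_separated (T : X ≃ₜ X) (N : ℕ) {x : X}
    (hx : ∀ j, 0 < j → j < N → T^[j] x ≠ x) :
    ∃ V : Set X, IsOpen V ∧ x ∈ V ∧ ∀ j, 0 < j → j < N → ∀ y ∈ V, T^[j] y ∉ V := by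
  have h : ∀ j, ∃ V : Set X, IsOpen V ∧ x ∈ V ∧ (0 < j → j < N → ∀ y ∈ V, T^[j] y ∉ V) := by
    intro j
    by_cases hj : 0 < j ∧ j < N
    · obtain ⟨u, v, hu, hv, hxu, hxv, huv⟩ := t2_separation (hx j hj.1 hj.2)
      refine ⟨v ∩ T^[j] ⁻¹' u, hv.inter (hu.preimage (T.continuous.iterate j)), ⟨hxv, hxu⟩, ?_⟩
      intro _ _ y hy hy'
      exact disjoint_left.1 huv hy.2 hy'.1
    · exact ⟨univ, isOpen_univ, mem_univ x, fun h1 h2 => absurd ⟨h1, h2⟩ hj⟩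
  choose V hVo hxV hV using h
  refine ⟨⋂ j ∈ Finset.range N, V j, isOpen_biInter_finset fun j _ => hVo j, by simp [hxV], ?_⟩
  intro j h0 hj y hy hy'
  simp only [Finset.mem_range, mem_iInter] at hy hy'
  exact hV j h0 hj y (hy j hj) (hy' j hj)

/-- A Borel marker set: its return times are at least `N`, and every point without period below `N`
is at distance less than `N` from it along its orbit. -/
lemma exists_marker (T : X ≃ₜ X) (N : ℕ) :
    ∃ B : Set X, MeasurableSet B ∧ (∀ j, 0 < j → j < N → ∀ y ∈ B, T^[j] y ∉ B) ∧
      ∀ x, (∀ j, 0 < j → j < N → T^[j] x ≠ x) → 0 < N →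
        ∃ j < N, T^[j] x ∈ B ∨ T.symm^[j] x ∈ B := by
  classical
  let b := TopologicalSpace.countableBasis X
  have hb : b.Countable := TopologicalSpace.countable_countableBasis X
  have hbas : TopologicalSpace.IsTopologicalBasis b := TopologicalSpace.isBasis_countableBasis X
  -- The empty set is added only to make the family nonempty, so that ℕ enumerates it.
  let b' : Set (Set X) := insert ∅ {V ∈ b | ∀ j, 0 < j → j < N → ∀ y ∈ V, T^[j] y ∉ V}
  have hb' : b'.Countable := (hb.mono (sep_subset _ _)).insert _
  obtain ⟨V, hV⟩ := hb'.exists_eq_range (insert_nonempty _ _)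
  have hVmem : ∀ i, V i ∈ b' := fun i => hV ▸ mem_range_self i
  have hVo : ∀ i, IsOpen (V i) := by
    intro i
    rcases hVmem i with h | h
    · rw [h]; exact isOpen_empty
    · exact hbas.isOpen h.1
  have hVs : ∀ i, ∀ j, 0 < j → j < N → ∀ y ∈ V i, T^[j] y ∉ V i := by
    intro i
    rcases hVmem i with h | h
    · rw [h]; simp
    · exact h.2
  let near : Set X → Set X := fun B => ⋃ j ∈ Finset.range N, (T^[j] ⁻¹' B ∪ T.symm^[j] ⁻¹' B)
  have hnear : ∀ (B : Set X) x, x ∈ near B ↔ ∃ j < N, T^[j] x ∈ B ∨ T.symm^[j] x ∈ B := by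
    intro B x; simp [near]
  -- Greedy choice: a point of `V i` becomes a marker unless an earlier marker lies within N of it
  -- on its orbit. Separation survives, and after this stage each point of `V i` has a marker
  -- nearby.
  let B : ℕ → Set X := fun i => Nat.rec ∅ (fun i Bi => Bi ∪ (V i \ near Bi)) i
  have hBs : ∀ i, B (i + 1) = B i ∪ (V i \ near (B i)) := fun i => rfl
  have hBm : ∀ i, MeasurableSet (B i) := by
    intro i
    induction i with
    | zero => exact MeasurableSet.empty
    | succ i ih =>
      rw [hBs]
      refine ih.union ((hVo i).measurableSet.diff (Finset.measurableSet_biUnion _ fun j _ => ?_))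
      exact ((T.continuous.iterate j).measurable ih).union
        ((T.symm.continuous.iterate j).measurable ih)
  have hmono : Monotone B := monotone_nat_of_le_succ fun i => by
    rw [hBs]; exact subset_union_left
  have hsep : ∀ i, ∀ j, 0 < j → j < N → ∀ y ∈ B i, T^[j] y ∉ B i := by
    intro i
    induction i with
    | zero => intro j _ _ y hy; exact absurd hy (notMem_empty y)
    | succ i ih =>
      intro j h0 hj y hy hy'
      rw [hBs] at hy hy'
      rcases hy with hy | hy <;> rcases hy' with hy' | hy'
      · exact ih j h0 hj y hy hy'
      · refine hy'.2 ((hnear _ _).2 ⟨j, hj, Or.inr ?_⟩)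
        rwa [Function.LeftInverse.iterate T.symm_apply_apply j y]
      · exact hy.2 ((hnear _ _).2 ⟨j, hj, Or.inl hy'⟩)
      · exact hVs i j h0 hj y hy.1 hy'.1
  refine ⟨⋃ i, B i, MeasurableSet.iUnion hBm, ?_, ?_⟩
  · intro j h0 hj y hy hy'
    obtain ⟨i, hi⟩ := mem_iUnion.1 hy
    obtain ⟨i', hi'⟩ := mem_iUnion.1 hy'
    exact hsep (max i i') j h0 hj y (hmono (le_max_left _ _) hi) (hmono (le_max_right _ _) hi')
  · intro x hx hN
    obtain ⟨W, hWo, hxW, hW⟩ := exists_open_separated T N hx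
    obtain ⟨W', hW'b, hxW', hWW'⟩ := hbas.exists_subset_of_mem_open hxW hWo
    have : W' ∈ b' := Or.inr ⟨hW'b, fun j h0 hj y hy hy' => hW j h0 hj y (hWW' hy) (hWW' hy')⟩
    rw [hV] at this
    obtain ⟨i, rfl⟩ := this
    by_cases hn : x ∈ near (B i)
    · obtain ⟨j, hj, h⟩ := (hnear _ _).1 hn
      exact ⟨j, hj, h.imp (fun h => mem_iUnion.2 ⟨i, h⟩) fun h => mem_iUnion.2 ⟨i, h⟩⟩
    · exact ⟨0, hN, Or.inl (mem_iUnion.2 ⟨i + 1, by rw [hBs]; exact Or.inr ⟨hxW', hn⟩⟩)⟩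

end Marker

/-! ### Counting names cut by a marker set -/

section Counting

variable {X : Type*} {k : ℕ}

/-- All words of length `n`, as lists. -/
def allWords (k n : ℕ) : Finset (List (Fin k)) :=
  (Finset.univ : Finset (Fin n → Fin k)).image List.ofFn

lemma card_allWords_le (k n : ℕ) : (allWords k n).card ≤ k ^ n :=
  Finset.card_image_le.trans (by simp)

lemma ofFn_mem_allWords {n : ℕ} (w : Fin n → Fin k) : List.ofFn w ∈ allWords k n :=
  Finset.mem_image_of_mem _ (Finset.mem_univ _)

lemma ofFn_itinerary_add (T : X → X) (c : X → Fin k) (m n : ℕ) (x : X) :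
    List.ofFn (itinerary T c (m + n) x) =
      List.ofFn (itinerary T c m x) ++ List.ofFn (itinerary T c n (T^[m] x)) := by
  rw [List.ofFn_add]
  congr 2
  funext j
  simp only [itinerary, Fin.val_natAdd, ← Function.iterate_add_apply]
  congr 2; omega

/-- Split a name at a return to B and induct on its length. There are N possible gaps, and this
factor is paid by exp(-N(r' - r)) through `hsmall`; the prefactor k^(2N) covers the names shorter
than 2N. -/
lemma card_itineraries_from_marker (T : X → X) (c : X → Fin k) (B : Set X) {N : ℕ} (hk : 0 < k)
    {r r' : ℝ} (hr' : 0 ≤ r') (hrr : r ≤ r') (W : ℕ → Finset (List (Fin k)))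
    (hW : ∀ g, N ≤ g → ((W g).card : ℝ) ≤ Real.exp (g * r))
    (hret : ∀ x ∈ B, ∃ g, N ≤ g ∧ g < 2 * N ∧ T^[g] x ∈ B ∧
      List.ofFn (itinerary T c g x) ∈ W g)
    (hsmall : N * Real.exp (-(N * (r' - r))) ≤ 1) (n : ℕ) :
    ∃ F : Finset (List (Fin k)), (F.card : ℝ) ≤ k ^ (2 * N) * Real.exp (n * r') ∧
      ∀ x ∈ B, List.ofFn (itinerary T c n x) ∈ F := by
  classical
  -- For N = 0, `hret` asks for g < 0, so B is empty.
  rcases Nat.eq_zero_or_pos N with rfl | hN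
  · refine ⟨∅, by simp; positivity, fun x hx => ?_⟩
    obtain ⟨g, -, h, -⟩ := hret x hx
    simp at h
  induction n using Nat.strong_induction_on with
  | _ n ih =>
  have hk1 : (1 : ℝ) ≤ k := by exact_mod_cast hk
  by_cases hn : n < 2 * N
  · refine ⟨allWords k n, ?_, fun x _ => ofFn_mem_allWords _⟩
    calc ((allWords k n).card : ℝ) ≤ (k : ℝ) ^ n := by exact_mod_cast card_allWords_le k n
      _ ≤ (k : ℝ) ^ (2 * N) := pow_le_pow_right₀ hk1 hn.le
      _ ≤ (k : ℝ) ^ (2 * N) * Real.exp (n * r') :=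
        le_mul_of_one_le_right (by positivity) (Real.one_le_exp (by positivity))
  push Not at hn
  have h1 : ∀ g ∈ Finset.Ico N (2 * N), ∃ F : Finset (List (Fin k)),
      (F.card : ℝ) ≤ k ^ (2 * N) * Real.exp ((n - g : ℕ) * r') ∧
      ∀ x ∈ B, List.ofFn (itinerary T c (n - g) x) ∈ F := fun g hg =>
    ih (n - g) (by have := Finset.mem_Ico.1 hg; omega)
  choose! F hF using h1
  refine ⟨(Finset.Ico N (2 * N)).biUnion fun g => Finset.image₂ (· ++ ·) (W g) (F g), ?_, ?_⟩
  · calc _ ≤ ∑ g ∈ Finset.Ico N (2 * N), ((Finset.image₂ (· ++ ·) (W g) (F g)).card : ℝ) := by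
          exact_mod_cast Finset.card_biUnion_le
      _ ≤ ∑ g ∈ Finset.Ico N (2 * N),
            k ^ (2 * N) * Real.exp (n * r') * Real.exp (-(N * (r' - r))) := by
          refine Finset.sum_le_sum fun g hg => ?_
          have hg' := Finset.mem_Ico.1 hg
          have hgn : g ≤ n := by omega
          have hNg : (N : ℝ) ≤ g := by exact_mod_cast hg'.1
          calc ((Finset.image₂ (· ++ ·) (W g) (F g)).card : ℝ) ≤ (W g).card * (F g).card := by
                exact_mod_cast Finset.card_image₂_le _ _ _
            _ ≤ Real.exp (g * r) * (k ^ (2 * N) * Real.exp ((n - g : ℕ) * r')) := by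
                gcongr
                · exact hW g hg'.1
                · exact (hF g hg).1
            _ = k ^ (2 * N) * Real.exp (n * r') * Real.exp (-(g * (r' - r))) := by
                rw [mul_left_comm, mul_assoc, ← Real.exp_add, ← Real.exp_add, Nat.cast_sub hgn]
                congr 2; ring
            _ ≤ _ := by
                gcongr
      _ = k ^ (2 * N) * Real.exp (n * r') * (N * Real.exp (-(N * (r' - r)))) := by
          rw [Finset.sum_const, Nat.card_Ico, nsmul_eq_mul]
          have : 2 * N - N = N := by omega
          rw [this]; ring
      _ ≤ _ := mul_le_of_le_one_right (by positivity) hsmall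
  · intro x hx
    obtain ⟨g, hg1, hg2, hgB, hgW⟩ := hret x hx
    have hg : g ∈ Finset.Ico N (2 * N) := Finset.mem_Ico.2 ⟨hg1, hg2⟩
    refine Finset.mem_biUnion.2 ⟨g, hg, Finset.mem_image₂.2 ⟨_, hgW, _, (hF g hg).2 _ hgB, ?_⟩⟩
    rw [← ofFn_itinerary_add]
    have : g + (n - g) = n := by omega
    rw [this]

lemma card_itineraries (T : X → X) (c : X → Fin k) (B P : Set X) {N M : ℕ} (hk : 0 < k)
    {r r' : ℝ} (hr' : 0 ≤ r') (hrr : r ≤ r') (W : ℕ → Finset (List (Fin k)))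
    (hW : ∀ g, N ≤ g → ((W g).card : ℝ) ≤ Real.exp (g * r))
    (hret : ∀ x ∈ B, ∃ g, N ≤ g ∧ g < 2 * N ∧ T^[g] x ∈ B ∧
      List.ofFn (itinerary T c g x) ∈ W g)
    (hsmall : N * Real.exp (-(N * (r' - r))) ≤ 1)
    (hM : 0 < M) (hP : ∀ x ∈ P, T^[M] x = x) (hhit : ∀ x ∉ P, ∃ t < 2 * N, T^[t] x ∈ B) :
    ∃ C : ℝ, 0 < C ∧ ∀ n, 2 * N ≤ n → ∃ F : Finset (List (Fin k)),
      (F.card : ℝ) ≤ C * Real.exp (n * r') ∧ ∀ x, List.ofFn (itinerary T c n x) ∈ F := by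
  classical
  have hk0 : (0 : ℝ) < k := by exact_mod_cast hk
  -- The term k^M counts the names of points of P, which repeat their first M letters; the sum runs
  -- over the time t of a first stretch leading into B.
  refine ⟨k ^ M + ∑ t ∈ Finset.range (2 * N), (k : ℝ) ^ t * k ^ (2 * N), by positivity, ?_⟩
  intro n hn
  choose F hFc hF using
    card_itineraries_from_marker T c B hk hr' hrr W hW hret hsmall
  let FP : Finset (List (Fin k)) := (Finset.univ : Finset (Fin M → Fin k)).image
    fun w => List.ofFn fun j : Fin n => w ⟨j % M, Nat.mod_lt _ hM⟩
  refine ⟨FP ∪ (Finset.range (2 * N)).biUnion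
    fun t => Finset.image₂ (· ++ ·) (allWords k t) (F (n - t)), ?_, ?_⟩
  · have h1 : (FP.card : ℝ) ≤ k ^ M * Real.exp (n * r') := by
      have : (FP.card : ℝ) ≤ k ^ M := by
        have : FP.card ≤ k ^ M := Finset.card_image_le.trans (by simp)
        exact_mod_cast this
      exact this.trans (le_mul_of_one_le_right (by positivity) (Real.one_le_exp (by positivity)))
    have h2 : (((Finset.range (2 * N)).biUnion
        fun t => Finset.image₂ (· ++ ·) (allWords k t) (F (n - t))).card : ℝ) ≤
        ∑ t ∈ Finset.range (2 * N), (k : ℝ) ^ t * k ^ (2 * N) * Real.exp (n * r') := by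
      calc _ ≤ ∑ t ∈ Finset.range (2 * N),
            ((Finset.image₂ (· ++ ·) (allWords k t) (F (n - t))).card : ℝ) := by
              exact_mod_cast Finset.card_biUnion_le
        _ ≤ _ := by
          refine Finset.sum_le_sum fun t _ => ?_
          calc _ ≤ ((allWords k t).card : ℝ) * (F (n - t)).card := by
                exact_mod_cast Finset.card_image₂_le _ _ _
            _ ≤ (k : ℝ) ^ t * (k ^ (2 * N) * Real.exp ((n - t : ℕ) * r')) := by
                gcongr
                · exact_mod_cast card_allWords_le k t
                · exact hFc _
            _ ≤ (k : ℝ) ^ t * (k ^ (2 * N) * Real.exp (n * r')) := by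
                gcongr
                exact Nat.sub_le n t
            _ = _ := by ring
    calc _ ≤ (FP.card : ℝ) + _ := by exact_mod_cast Finset.card_union_le _ _
      _ ≤ _ := add_le_add h1 h2
      _ = _ := by rw [add_mul, Finset.sum_mul]
  · intro x
    by_cases hx : x ∈ P
    · refine Finset.mem_union_left _ (Finset.mem_image.2 ⟨itinerary T c M x, Finset.mem_univ _, ?_⟩)
      congr 1
      funext j
      simp only [itinerary]
      rw [Function.IsPeriodicPt.iterate_mod_apply (hP x hx)]
    · obtain ⟨t, ht, htB⟩ := hhit x hx
      refine Finset.mem_union_right _ (Finset.mem_biUnion.2 ⟨t, Finset.mem_range.2 ht,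
        Finset.mem_image₂.2 ⟨_, ofFn_mem_allWords (itinerary T c t x), _, hF (n - t) _ htB, ?_⟩⟩)
      rw [← ofFn_itinerary_add]
      have : t + (n - t) = n := by omega
      rw [this]

end Counting

lemma measurable_diag {X β : Type*} [MeasurableSpace X] [MeasurableSpace β] {G : ℕ → X → β}
    (hG : ∀ n, Measurable (G n)) {b : X → ℕ} (hb : Measurable b) :
    Measurable fun x => G (b x) x :=
  (measurable_from_prod_countable_right (f := fun p : ℕ × X => G p.1 p.2) hG).comp
    (hb.prodMk measurable_id)

/-! ### The universal refining partition -/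

section Universal

variable {X : Type*} [TopologicalSpace X] [T2Space X] [SecondCountableTopology X]
  [MeasurableSpace X] [BorelSpace X]

/-- Words selected from a family `φ g` of length-`g` words, read along the gaps between
consecutive visits to a marker set. -/
lemma exists_label_of_marker (T : X ≃ₜ X) {k : ℕ} (U : Fin k → Set X) (N : ℕ) (hN : 0 < N)
    (φ : (g : ℕ) → X → (Fin g → Fin k)) (hφm : ∀ g, Measurable (φ g))
    (hφU : ∀ g x, x ∈ wordSet T U (φ g x)) :
    ∃ c : X → Fin k, Measurable c ∧ (∀ x, x ∈ U (c x)) ∧ ∃ B P : Set X, ∃ M, 0 < M ∧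
      (∀ x ∈ P, T^[M] x = x) ∧ (∀ x ∉ P, ∃ t < 2 * N, T^[t] x ∈ B) ∧
      ∀ x ∈ B, ∃ g, N ≤ g ∧ g < 2 * N ∧ T^[g] x ∈ B ∧ itinerary T c g x = φ g x := by
  classical
  obtain ⟨B₀, hB₀m, hB₀s, hB₀⟩ := exists_marker T N
  -- Every 0 < j < N divides N!, so a point outside P has no period below N and the marker property
  -- applies to it.
  set M := N.factorial
  have hM : 0 < M := Nat.factorial_pos N
  let P : Set X := {x | T^[M] x = x}
  have hPm : MeasurableSet P := (isClosed_eq (T.continuous.iterate M) continuous_id).measurableSet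
  have hPT : ∀ x, T x ∈ P ↔ x ∈ P := by
    intro x
    simp only [P, mem_ofPred_eq, ← Function.iterate_succ_apply, Function.iterate_succ_apply',
      T.injective.eq_iff]
  have hPTn : ∀ n x, T^[n] x ∈ P ↔ x ∈ P := by
    intro n
    induction n with
    | zero => simp
    | succ n ih => intro x; rw [Function.iterate_succ_apply, ih, hPT]
  have hLR : ∀ n x, T.symm^[n] (T^[n] x) = x := fun n x =>
    Function.LeftInverse.iterate T.symm_apply_apply n x
  have hRL : ∀ n x, T^[n] (T.symm^[n] x) = x := fun n x =>
    Function.LeftInverse.iterate T.apply_symm_apply n x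
  have hSub : ∀ m n x, m ≤ n → T.symm^[m] (T^[n] x) = T^[n - m] x := by
    intro m n x h
    conv_lhs => rw [← Nat.add_sub_cancel' h, Function.iterate_add_apply, hLR]
  have hSub' : ∀ m n x, m ≤ n → T^[m] (T.symm^[n] x) = T.symm^[n - m] x := by
    intro m n x h
    conv_lhs => rw [← Nat.add_sub_cancel' h, Function.iterate_add_apply, hRL]
  have hPSn : ∀ n x, T.symm^[n] x ∈ P ↔ x ∈ P := by
    intro n x; rw [← hPTn n, hRL]
  -- P is invariant under T and its inverse, so orbits outside P lose no markers.
  let B : Set X := B₀ \ P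
  have hBm : MeasurableSet B := hB₀m.diff hPm
  have hBs : ∀ j, 0 < j → j < N → ∀ y ∈ B, T^[j] y ∉ B := fun j h0 hj y hy hy' =>
    hB₀s j h0 hj y hy.1 hy'.1
  have hB : ∀ x ∉ P, ∃ j < N, T^[j] x ∈ B ∨ T.symm^[j] x ∈ B := by
    intro x hx
    obtain ⟨j, hj, h⟩ := hB₀ x (fun j h0 hj hjx => hx (by
      exact Function.IsPeriodicPt.trans_dvd (f := T) (m := j) hjx
        (Nat.dvd_factorial h0 hj.le))) hN
    exact ⟨j, hj, h.imp (fun h => ⟨h, by rwa [hPTn]⟩) fun h => ⟨h, by rwa [hPSn]⟩⟩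
  have hfwd : ∀ x ∉ P, ∃ j, 0 < j ∧ j < 2 * N ∧ T^[j] x ∈ B := by
    intro x hx
    -- Looking from T^N x moves the two-sided search into the future: the visit happens at time N +
    -- j or N - j, strictly between 0 and 2N.
    obtain ⟨j, hj, h | h⟩ := hB (T^[N] x) (by rwa [hPTn])
    · exact ⟨j + N, by omega, by omega, by rwa [Function.iterate_add_apply]⟩
    · rw [hSub _ _ _ hj.le] at h
      exact ⟨N - j, by omega, by omega, h⟩
  have hbwd : ∀ x ∉ P, ∃ j, T.symm^[j] x ∈ B := by
    intro x hx
    obtain ⟨j, hj, h | h⟩ := hB (T.symm^[N] x) (by rwa [hPSn])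
    · rw [hSub' _ _ _ hj.le] at h
      exact ⟨_, h⟩
    · exact ⟨j + N, by rwa [Function.iterate_add_apply]⟩
  have hback : ∀ x, ∃ j, x ∈ P ∨ T.symm^[j] x ∈ B := by
    intro x
    by_cases hx : x ∈ P
    · exact ⟨0, Or.inl hx⟩
    · exact (hbwd x hx).imp fun _ h => Or.inr h
  have hnext : ∀ x, ∃ j, x ∈ P ∨ (0 < j ∧ T^[j] x ∈ B) := by
    intro x
    by_cases hx : x ∈ P
    · exact ⟨0, Or.inl hx⟩
    · exact (hfwd x hx).imp fun _ h => Or.inr ⟨h.1, h.2.2⟩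
  let back : X → ℕ := fun x => Nat.find (hback x)
  let next : X → ℕ := fun x => Nat.find (hnext x)
  have hbackm : Measurable back := measurable_find hback fun j =>
    hPm.union ((T.symm.continuous.iterate j).measurable hBm)
  have hnextm : Measurable next := measurable_find hnext fun j =>
    hPm.union ((MeasurableSet.const _).inter ((T.continuous.iterate j).measurable hBm))
  -- `b` is the position in a block, `g` its length and `y` its starting point. The default for b ≥
  -- g only makes the function total: by `hlt` it is never read, as otherwise `back` would have
  -- found a later marker.
  let letter : ℕ → ℕ → X → Fin k := fun b g y =>
    if h : b < g then φ g y ⟨b, h⟩ else φ 1 y 0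
  have hletter : ∀ b g, Measurable (letter b g) := by
    intro b g
    by_cases h : b < g
    · simp only [letter, h, dif_pos]; exact (measurable_pi_apply _).comp (hφm g)
    · simp only [letter, h, dif_neg, not_false_eq_true]
      exact (measurable_pi_apply _).comp (hφm 1)
  let c : X → Fin k := fun x => if x ∈ P then φ 1 x 0 else
    letter (back x) (next (T.symm^[back x] x)) (T.symm^[back x] x)
  have hcm : Measurable c := by
    refine Measurable.ite hPm ((measurable_pi_apply _).comp (hφm 1)) ?_
    refine measurable_diag
      (G := fun b x => letter b (next (T.symm^[b] x)) (T.symm^[b] x)) (fun b => ?_) hbackm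
    exact (measurable_diag (G := fun g y => letter b g y) (hletter b) hnextm).comp
      (T.symm.continuous.iterate b).measurable
  refine ⟨c, hcm, ?_, B, P, M, hM, fun x hx => hx, fun x hx => ?_, ?_⟩
  · intro x
    by_cases hx : x ∈ P
    · simp only [c, hx, if_true]
      exact mem_wordSet.1 (hφU 1 x) 0
    · simp only [c, hx, if_false]
      set b := back x
      set y := T.symm^[b] x
      have hyB : y ∈ B := (Nat.find_spec (hback x)).resolve_left hx
      have hyP : y ∉ P := hyB.2
      obtain ⟨hg0, hgB⟩ := (Nat.find_spec (hnext y)).resolve_left hyP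
      have hlt : b < next y := by
        by_contra! hle
        rw [hSub' _ _ _ hle] at hgB
        exact Nat.find_min (hback x) (m := b - next y) (Nat.sub_lt (hg0.trans_le hle) hg0)
          (Or.inr hgB)
      simp only [letter, hlt, dif_pos]
      have := mem_wordSet.1 (hφU (next y) y) ⟨b, hlt⟩
      rwa [hRL] at this
  · obtain ⟨j, -, h2, h3⟩ := hfwd x hx
    exact ⟨j, h2, h3⟩
  · intro x hxB
    have hxP : x ∉ P := hxB.2
    obtain ⟨hg0, hgB⟩ := (Nat.find_spec (hnext x)).resolve_left hxP
    refine ⟨next x, ?_, ?_, hgB, ?_⟩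
    · by_contra! h
      exact hBs _ hg0 h x hxB hgB
    · obtain ⟨j, h1, h2, h3⟩ := hfwd x hxP
      exact (Nat.find_min' (hnext x) (Or.inr ⟨h1, h3⟩)).trans_lt h2
    · funext ⟨j, hj⟩
      have hjP : T^[j] x ∉ P := by rwa [hPTn]
      have hbj : back (T^[j] x) = j := by
        refine (Nat.find_eq_iff _).2 ⟨Or.inr (by rwa [hLR]), fun i hi h => ?_⟩
        have h' := h.resolve_left hjP
        rw [hSub _ _ _ hi.le] at h'
        exact Nat.find_min (hnext x) (m := j - i) ((Nat.sub_le _ _).trans_lt hj)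
          (Or.inr ⟨by omega, h'⟩)
      simp only [itinerary, c, hjP, if_false, hbj, hLR]
      simp only [letter, hj, dif_pos]

lemma eventually_log_coverNumber_le {T : X → X} {k : ℕ} {U : Fin k → Set X} {r : ℝ}
    (h : topEntropy T U < r) : ∀ᶠ n : ℕ in atTop, Real.log (coverNumber T U n) ≤ n * r := by
  have := eventually_lt_of_limsup_lt h (by isBoundedDefault)
  filter_upwards [this, eventually_gt_atTop 0] with n hn hn0
  have hn' : (0 : ℝ) < n := by exact_mod_cast hn0
  have h1 : Real.log (coverNumber T U n) / n < r := by exact_mod_cast hn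
  rw [div_lt_iff₀ hn'] at h1
  linarith

lemma limsup_div_le_of_eventually_le {u : ℕ → ℝ} {C r : ℝ}
    (h : ∀ᶠ n : ℕ in atTop, u n ≤ C + n * r) :
    limsup (fun n : ℕ => ((u n / n : ℝ) : EReal)) atTop ≤ r := by
  have hlim : Tendsto (fun n : ℕ => ((C / n + r : ℝ) : EReal)) atTop (nhds (r : EReal)) := by
    refine (continuous_coe_real_ereal.tendsto r).comp ?_
    simpa using (tendsto_const_div_atTop_nhds_zero_nat C).add_const r
  rw [← hlim.limsup_eq]
  refine limsup_le_limsup ?_ (by isBoundedDefault) (by isBoundedDefault)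
  filter_upwards [h, eventually_gt_atTop 0] with n hn hn0
  have hn' : (0 : ℝ) < n := by exact_mod_cast hn0
  have : u n / n ≤ C / n + r := by
    rw [div_le_iff₀ hn', add_mul, div_mul_cancel₀ _ hn'.ne']; linarith
  exact_mod_cast this

/-- A refining Borel partition whose entropy is uniformly controlled by the topological entropy. -/
lemma exists_refining_partition_entropy_le [Nonempty X] (T : X ≃ₜ X) {k : ℕ} (U : Fin k → Set X)
    (hUo : ∀ i, IsOpen (U i)) (hUc : (⋃ i, U i) = univ) {r' : ℝ} (hr' : topEntropy T U < r') :
    ∃ α ∈ refiningPartitions U, ∀ μ : Measure X, IsProbabilityMeasure μ →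
      measureEntropy T μ α ≤ r' := by
  classical
  -- Subcovers are counted at rate r; the gap r' - r pays for the choice of block lengths.
  obtain ⟨r, hr, hrr'⟩ := EReal.exists_between_coe_real hr'
  have hrr : r < r' := by exact_mod_cast hrr'
  have hr0 : 0 < r := by exact_mod_cast topEntropy_nonneg.trans_lt hr
  have hk : 0 < k := by
    obtain ⟨i, -⟩ := mem_iUnion.1 (hUc ▸ mem_univ (Classical.arbitrary X))
    exact i.pos
  have hlim : Tendsto (fun n : ℕ => (n : ℝ) * Real.exp (-(n * (r' - r)))) atTop (nhds 0) := by
    have h1 := (Real.tendsto_pow_mul_exp_neg_atTop_nhds_zero 1).comp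
      (tendsto_natCast_atTop_atTop.atTop_mul_const (sub_pos.2 hrr))
    have h2 := h1.div_const (r' - r)
    rw [zero_div] at h2
    refine h2.congr fun n => ?_
    have : r' - r ≠ 0 := (sub_pos.2 hrr).ne'
    simp only [Function.comp, pow_one]
    field_simp
  obtain ⟨N₀, hN₀⟩ := eventually_atTop.1 (eventually_log_coverNumber_le hr)
  obtain ⟨N, hNN₀, hN1, hN0⟩ := ((eventually_ge_atTop N₀).and
    ((hlim.eventually_le_const one_pos).and (eventually_gt_atTop 0))).exists
  choose W₀ hW₀ hW₀c using fun n => exists_card_eq_coverNumber (T := T) hUc n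
  have hwm : ∀ (n : ℕ) (w : Fin n → Fin k), MeasurableSet (wordSet T U w) := fun n w =>
    (isOpen_iInter_of_finite fun j : Fin n =>
      (hUo (w j)).preimage (T.continuous.iterate j)).measurableSet
  have : Nonempty (Fin k) := ⟨⟨0, hk⟩⟩
  choose φ hφm hφ using fun n =>
    exists_measurable_selection (fun w : Fin n → Fin k => wordSet T U w) (hwm n) (W₀ n)
  obtain ⟨c, hcm, hcU, B, P, M, hM, hPM, hhit, hret⟩ := exists_label_of_marker T U N hN0 φ hφm
    fun g x => (hφ g x (hW₀c g ▸ mem_univ x)).2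
  obtain ⟨C, hC, hF⟩ := card_itineraries T c B P hk (hr0.trans hrr).le hrr.le
    (fun g => (W₀ g).image List.ofFn) (N := N) (fun g hg => by
      have h1 := hN₀ g (hNN₀.trans hg)
      have h2 : (0 : ℝ) < coverNumber T U g := by exact_mod_cast coverNumber_pos hUc g
      calc (((W₀ g).image List.ofFn).card : ℝ) ≤ (W₀ g).card := by
            exact_mod_cast Finset.card_image_le
        _ = coverNumber T U g := by rw [hW₀]
        _ ≤ _ := (Real.log_le_iff_le_exp h2).1 h1)
    (fun x hx => by
      obtain ⟨g, h1, h2, h3, h4⟩ := hret x hx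
      exact ⟨g, h1, h2, h3, h4 ▸ Finset.mem_image_of_mem _ (hφ g x (hW₀c g ▸ mem_univ x)).1⟩)
    hN1 hM hPM hhit
  refine ⟨FinPartition.ofFun c hcm, fun a => ⟨a, fun x hx => ?_⟩, fun μ hμ => ?_⟩
  · have : c x = a := hx
    exact this ▸ hcU x
  · refine limsup_div_le_of_eventually_le (C := Real.log C) ?_
    filter_upwards [eventually_ge_atTop (2 * N)] with n hn
    rw [shannonEntropy_ofFun]
    obtain ⟨F, hFc, hFm⟩ := hF n hn
    let F' : Finset (Fin n → Fin k) := Finset.univ.filter fun w => List.ofFn w ∈ F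
    have hF' : F'.card ≤ F.card := Finset.card_le_card_of_injOn List.ofFn
      (fun w hw => (Finset.mem_filter.1 hw).2) List.ofFn_injective.injOn
    have hmem : ∀ x, itinerary T c n x ∈ F' := fun x =>
      Finset.mem_filter.2 ⟨Finset.mem_univ _, hFm x⟩
    have hpos : 0 < F'.card := Finset.card_pos.2 ⟨_, hmem (Classical.arbitrary X)⟩
    refine (entropy_le_log_card μ (measurable_itinerary T.continuous.measurable hcm n) F'
      hmem).trans ?_
    calc Real.log F'.card ≤ Real.log (C * Real.exp (n * r')) := by
          refine Real.log_le_log (by exact_mod_cast hpos) (le_trans ?_ hFc)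
          exact_mod_cast hF'
      _ = _ := by rw [Real.log_mul hC.ne' (Real.exp_ne_zero _), Real.log_exp]

lemma infSupEntropy_le_topEntropy [Nonempty X] (T : X ≃ₜ X) {k : ℕ} (U : Fin k → Set X)
    (hUo : ∀ i, IsOpen (U i)) (hUc : (⋃ i, U i) = univ) :
    infSupEntropy T U ≤ topEntropy T U := by
  refine EReal.le_of_forall_lt_iff_le.1 fun r hr => ?_
  obtain ⟨α, hα, h⟩ := exists_refining_partition_entropy_le T U hUo hUc hr
  exact (iInf₂_le α hα).trans (iSup₂_le fun μ _ => h μ inferInstance)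

lemma iInf_measureEntropy_le_topEntropy [Nonempty X] (T : X ≃ₜ X) {k : ℕ} (U : Fin k → Set X)
    (hUo : ∀ i, IsOpen (U i)) (hUc : (⋃ i, U i) = univ) (μ : ProbabilityMeasure X) :
    ⨅ α ∈ refiningPartitions U, measureEntropy T (μ : Measure X) α ≤ topEntropy T U := by
  refine EReal.le_of_forall_lt_iff_le.1 fun r hr => ?_
  obtain ⟨α, hα, h⟩ := exists_refining_partition_entropy_le T U hUo hUc hr
  exact (iInf₂_le α hα).trans (h μ inferInstance)

end Universal

/-! ### Separated sets and orbit averages -/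

section Finite

variable {X : Type*} [MeasurableSpace X]

/-- A finite set which meets each atom of each `α_0^{n-1}` at most once and is almost as large as
the minimal subcover. -/
lemma exists_separated_finset (T : X → X) {k : ℕ} {U : Fin k → Set X} {J : Type*}
    (s : Finset J) (hs : s.Nonempty) (A : J → FinPartition X) (hA : ∀ l, A l ∈ refiningPartitions U)
    {K : ℕ} (hK : s.card ≤ K) (n : ℕ) (m : ℕ) (hm : K * m < coverNumber T U n + K) :
    ∃ B : Finset X, B.card = m ∧ ∀ l ∈ s, InjOn (itinerary T (A l).label n) B := by
  classical
  induction m with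
  | zero => exact ⟨∅, rfl, by simp⟩
  | succ m ih =>
    obtain ⟨B, hBm, hB⟩ := ih (by rw [Nat.mul_succ] at hm; omega)
    choose f hf using fun l => FinPartition.label_spec (hA l)
    -- For each chosen point and each partition, this is a U-word whose set contains the whole cell
    -- of that point. Since `hm` says m + 1 ≤ ⌈N/K⌉, there are too few such words to cover X, and
    -- any uncovered point has new names for all partitions.
    let F : Finset (Fin n → Fin k) := (s ×ˢ B).image
      fun p => fun j => f p.1 (itinerary T (A p.1).label n p.2 j)
    have hFc : F.card < coverNumber T U n := by
      calc F.card ≤ (s ×ˢ B).card := Finset.card_image_le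
        _ = s.card * m := by rw [Finset.card_product, hBm]
        _ ≤ K * m := Nat.mul_le_mul_right m hK
        _ < _ := by rw [Nat.mul_succ] at hm; omega
    have hnot : (⋃ w ∈ F, wordSet T U w) ≠ univ := fun h =>
      absurd (coverNumber_le_card F h) (not_le.2 hFc)
    obtain ⟨y, hy⟩ := (ne_univ_iff_exists_notMem _).1 hnot
    have hsep : ∀ l ∈ s, ∀ x ∈ B, itinerary T (A l).label n x ≠ itinerary T (A l).label n y := by
      intro l hl x hx h
      refine hy (mem_biUnion (x := fun j => f l (itinerary T (A l).label n x j))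
        (Finset.mem_coe.2 (Finset.mem_image.2 ⟨(l, x), Finset.mem_product.2 ⟨hl, hx⟩, rfl⟩)) ?_)
      rw [mem_wordSet]
      intro j
      rw [h]
      exact hf l _
    obtain ⟨l₀, hl₀⟩ := hs
    refine ⟨insert y B, ?_, ?_⟩
    · rw [Finset.card_insert_of_notMem, hBm]
      intro hyB
      exact hsep l₀ hl₀ y hyB rfl
    · intro l hl
      rw [Finset.coe_insert, injOn_insert]
      · refine ⟨hB l hl, ?_⟩
        rintro ⟨x, hx, h⟩
        exact hsep l hl x hx h
      · intro hyB
        exact hsep l hl y hyB rfl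

lemma exists_average {ι : Type*} (s : Finset ι) (hs : s.Nonempty) (ν : ι → Measure X)
    (hν : ∀ i, IsProbabilityMeasure (ν i)) :
    ∃ μ : Measure X, IsProbabilityMeasure μ ∧
      ∀ A, μ.real A = (s.card : ℝ)⁻¹ * ∑ i ∈ s, (ν i).real A := by
  have hc : (s.card : ENNReal) ≠ 0 := by exact_mod_cast hs.card_pos.ne'
  refine ⟨(s.card : ENNReal)⁻¹ • ∑ i ∈ s, ν i, ⟨?_⟩, fun A => ?_⟩
  · simp [ENNReal.inv_mul_cancel hc]
  · rw [measureReal_ennreal_smul_apply]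
    simp only [measureReal_def, Measure.coe_finsetSum, Finset.sum_apply]
    rw [ENNReal.toReal_sum fun i _ => measure_ne_top _ _]
    simp

lemma exists_measure_log_card_le_entropy [MeasurableSingletonClass X] (B : Finset X)
    (hB : B.Nonempty) :
    ∃ ν : Measure X, IsProbabilityMeasure ν ∧ ∀ {ι : Type} [Fintype ι] [MeasurableSpace ι]
      [MeasurableSingletonClass ι] (f : X → ι), Measurable f → InjOn f B →
        Real.log B.card ≤ entropy ν f := by
  classical
  obtain ⟨ν, hν, h⟩ := exists_average B hB (fun x => Measure.dirac x) (fun x => inferInstance)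
  refine ⟨ν, hν, fun f hf hinj => log_le_entropy ν hf fun i => ?_⟩
  rw [h]
  refine mul_le_of_le_one_right (by positivity) ?_
  have h1 : ∀ x, (Measure.dirac x).real (f ⁻¹' {i}) = if f x = i then 1 else 0 := by
    intro x
    rw [measureReal_def, Measure.dirac_apply]
    by_cases hx : f x = i <;> simp [hx, indicator]
  simp only [h1, Finset.sum_boole]
  have : (B.filter fun x => f x = i).card ≤ 1 := Finset.card_le_one.2 fun a ha b hb => by
    rw [Finset.mem_filter] at ha hb
    exact hinj ha.1 hb.1 (ha.2.trans hb.2.symm)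
  exact_mod_cast this

/-- Orbit averages of a measure carried by a separated set have large entropy. -/
lemma exists_almost_invariant_measure [MeasurableSingletonClass X] [Nonempty X] {T : X → X}
    (hT : Measurable T)
    {k : ℕ} {U : Fin k → Set X} (hU : (⋃ i, U i) = univ) {J : Type*}
    (s : Finset J) (hs : s.Nonempty) (A : J → FinPartition X)
    (hA : ∀ l, A l ∈ refiningPartitions U) {n : ℕ} (hn : n ≠ 0) :
    ∃ μ : ProbabilityMeasure X,
      (∀ C, MeasurableSet C → |(μ : Measure X).real (T ⁻¹' C) - (μ : Measure X).real C| ≤ 1 / n) ∧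
      ∀ l ∈ s, ∀ m ≠ 0, m * (Real.log (coverNumber T U n) - Real.log s.card) ≤
        n * entropy (μ : Measure X) (itinerary T (A l).label m) +
          2 * m ^ 2 * Real.log (A l).size := by
  have hN := coverNumber_pos (T := T) hU n
  set N := coverNumber T U n
  have hK := hs.card_pos
  set K := s.card
  -- M = ⌈N/K⌉, so log M ≥ log N - log K; the loss log K does not depend on n.
  set M := (N + K - 1) / K
  have hM1 : K * M < N + K := by
    have := Nat.mul_div_le (N + K - 1) K
    simp only [M]; omega
  have hM2 : N ≤ K * M := by
    have := Nat.lt_mul_div_succ (N + K - 1) hK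
    rw [Nat.mul_add] at this
    simp only [M]; omega
  have hMpos : 0 < M := by
    rcases Nat.eq_zero_or_pos M with h | h
    · rw [h] at hM2; omega
    · exact h
  obtain ⟨B, hBc, hB⟩ := exists_separated_finset T s hs A hA le_rfl n M hM1
  obtain ⟨ν, hν, hνe⟩ := exists_measure_log_card_le_entropy B
    (Finset.card_pos.1 (hBc ▸ hMpos))
  have hνj : ∀ j, IsProbabilityMeasure (ν.map T^[j]) := fun j =>
    Measure.isProbabilityMeasure_map (hT.iterate j).aemeasurable
  obtain ⟨μ, hμ, hμA⟩ := exists_average (Finset.range n) (by simpa using hn)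
    (fun j => ν.map T^[j]) hνj
  rw [Finset.card_range] at hμA
  have hn0 : (0 : ℝ) < n := by positivity
  refine ⟨⟨μ, hμ⟩, fun C hC => ?_, fun l hl m hm => ?_⟩
  · simp only [ProbabilityMeasure.coe_mk]
    rw [hμA, hμA, ← mul_sub, ← Finset.sum_sub_distrib]
    have h1 : ∀ j, (ν.map T^[j]).real (T ⁻¹' C) - (ν.map T^[j]).real C =
        ν.real (T^[j + 1] ⁻¹' C) - ν.real (T^[j] ⁻¹' C) := by
      intro j
      rw [measureReal_def, measureReal_def, Measure.map_apply (hT.iterate j) (hT hC),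
        Measure.map_apply (hT.iterate j) hC, ← preimage_comp, ← Function.iterate_succ']
      rfl
    simp only [h1]
    -- The orbit average telescopes, leaving two boundary terms in [0, 1].
    rw [Finset.sum_range_sub fun j => ν.real (T^[j] ⁻¹' C), abs_mul, abs_of_pos (by positivity),
      one_div]
    refine mul_le_of_le_one_right (by positivity) (abs_le.2 ⟨?_, ?_⟩)
    · have h2 := measureReal_nonneg (μ := ν) (s := T^[n] ⁻¹' C)
      have h3 := measureReal_le_one (μ := ν) (s := T^[0] ⁻¹' C)
      linarith
    · have h2 := measureReal_nonneg (μ := ν) (s := T^[0] ⁻¹' C)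
      have h3 := measureReal_le_one (μ := ν) (s := T^[n] ⁻¹' C)
      linarith
  · have hc := (A l).measurable_label
    have h1 : Real.log N - Real.log K ≤ entropy ν (itinerary T (A l).label n) := by
      refine le_trans ?_ (hνe _ (measurable_itinerary hT hc n) (hB l hl))
      rw [hBc, sub_le_iff_le_add, ← Real.log_mul (by positivity) (by positivity)]
      refine Real.log_le_log (by positivity) ?_
      rw [mul_comm]; exact_mod_cast hM2
    have h2 := block_average_bound
      (fun i l' => entropy ν (fun x => itinerary T (A l).label l' (T^[i] x)))
      (Real.log (A l).size) (fun i l' => entropy_nonneg ν _)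
      (fun i l' => by simpa using itinerary_entropy_le ν hT hc i l')
      (itinerary_subadd ν hT hc) (fun i m n h => itinerary_mono ν hT hc i h) n m hm
      (Real.log_natCast_nonneg _)
    have h3 := average_entropy_le hn (fun j => ν.map T^[j]) μ (itinerary T (A l).label m)
      fun i => hμA _
    have h4 : ∀ j, entropy (ν.map T^[j]) (itinerary T (A l).label m) =
        entropy ν (fun x => itinerary T (A l).label m (T^[j] x)) := fun j =>
      entropy_map ν (hT.iterate j) (measurable_itinerary hT hc m)
    simp only [h4] at h3
    simp only [ProbabilityMeasure.coe_mk]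
    have h5 : (m : ℝ) * (Real.log N - Real.log K) ≤
        m * entropy ν (itinerary T (A l).label n) := by gcongr
    refine h5.trans (h2.trans ?_)
    linarith

end Finite

/-! ### Entropy rates of invariant measures -/

section Invariant

variable {X : Type*} [MeasurableSpace X]

lemma entropy_comp_of_measurePreserving {ι : Type*} [Fintype ι] [MeasurableSpace ι]
    [MeasurableSingletonClass ι] {μ : Measure X} {S : X → X} (hS : MeasurePreserving S μ μ)
    {f : X → ι} (hf : Measurable f) : entropy μ (fun x => f (S x)) = entropy μ f := by
  rw [← entropy_map μ hS.measurable hf, hS.map_eq]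

variable {ι : Type*} [Fintype ι] [MeasurableSpace ι] [MeasurableSingletonClass ι]
  {μ : Measure X} [IsProbabilityMeasure μ] {T : X → X} {c : X → ι}

lemma subadditive_entropy (hT : MeasurePreserving T μ μ) (hc : Measurable c) :
    Subadditive fun n => entropy μ (itinerary T c n) := by
  intro m n
  have := itinerary_subadd μ hT.measurable hc 0 m n
  rwa [entropy_comp_of_measurePreserving (hT.iterate (0 + m))
    (measurable_itinerary hT.measurable hc n)] at this

lemma entropy_itinerary_le (hT : MeasurePreserving T μ μ) (hc : Measurable c) (n : ℕ) :
    entropy μ (itinerary T c n) ≤ n * entropy μ c := by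
  induction n with
  | zero =>
    have := itinerary_entropy_le μ hT.measurable hc 0 0
    simpa using this
  | succ n ih =>
    have h1 := subadditive_entropy hT hc n 1
    have h2 : entropy μ (itinerary T c 1) ≤ entropy μ c :=
      entropy_le_of_factor μ hc (fun i _ => i) fun x => by
        funext j; simp [itinerary, Subsingleton.elim j 0]
    push_cast
    linarith

lemma bddBelow_entropy_div (μ : Measure X) [IsProbabilityMeasure μ] (T : X → X) (c : X → ι) :
    BddBelow (range fun n : ℕ => entropy μ (itinerary T c n) / n) :=
  ⟨0, by rintro _ ⟨n, rfl⟩; exact div_nonneg (entropy_nonneg _ _) (Nat.cast_nonneg n)⟩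

/-- By Fekete's lemma the `limsup` is a limit and equals the infimum of the quotients. -/
lemma measureEntropy_le_div (hT : MeasurePreserving T μ μ) (α : FinPartition X) {m : ℕ}
    (hm : m ≠ 0) :
    measureEntropy T μ α ≤ ((entropy μ (itinerary T α.label m) / m : ℝ) : EReal) := by
  have hsub := subadditive_entropy hT α.measurable_label
  have hb := bddBelow_entropy_div μ T α.label
  have h1 := hsub.tendsto_lim hb
  have h2 : Tendsto (fun n : ℕ => ((shannonEntropy T μ α n / n : ℝ) : EReal)) atTop
      (nhds (hsub.lim : EReal)) := by
    simp only [shannonEntropy_eq]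
    exact (continuous_coe_real_ereal.tendsto _).comp h1
  rw [measureEntropy, h2.limsup_eq]
  exact_mod_cast hsub.lim_le_div hb hm

lemma le_measureEntropy {α : FinPartition X} {r : ℝ}
    (h : ∀ m : ℕ, m * r ≤ entropy μ (itinerary T α.label m)) :
    (r : EReal) ≤ measureEntropy T μ α := by
  refine le_limsup_of_frequently_le (Eventually.frequently ?_) (by isBoundedDefault)
  filter_upwards [eventually_gt_atTop 0] with n hn
  have hn' : (0 : ℝ) < n := by exact_mod_cast hn
  rw [shannonEntropy_eq]
  have : r ≤ entropy μ (itinerary T α.label n) / n := by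
    rw [le_div_iff₀ hn', mul_comm]; exact h n
  exact_mod_cast this

lemma mul_le_entropy_of_le_measureEntropy (hT : MeasurePreserving T μ μ) {α : FinPartition X}
    {r : ℝ} (h : (r : EReal) ≤ measureEntropy T μ α) (m : ℕ) :
    m * r ≤ entropy μ (itinerary T α.label m) := by
  rcases eq_or_ne m 0 with rfl | hm
  · simpa using entropy_nonneg μ _
  · have hm' : (0 : ℝ) < m := by positivity
    have h1 : (r : EReal) ≤ _ := h.trans (measureEntropy_le_div hT α hm)
    have h2 : r ≤ entropy μ (itinerary T α.label m) / m := by exact_mod_cast h1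
    rwa [le_div_iff₀ hm', mul_comm] at h2

lemma eventually_entropy_le {α : FinPartition X} {r : ℝ} (h : measureEntropy T μ α < r) :
    ∀ᶠ n : ℕ in atTop, entropy μ (itinerary T α.label n) ≤ n * r := by
  have := eventually_lt_of_limsup_lt h (by isBoundedDefault)
  filter_upwards [this, eventually_gt_atTop 0] with n hn hn0
  have hn' : (0 : ℝ) < n := by exact_mod_cast hn0
  have h1 : shannonEntropy T μ α n / n < r := by exact_mod_cast hn
  rw [div_lt_iff₀ hn', shannonEntropy_eq] at h1
  linarith

end Invariant

lemma topEntropy_lt_top {X : Type*} [Nonempty X] {k : ℕ} (T : X → X) {U : Fin k → Set X}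
    (hU : (⋃ i, U i) = univ) : topEntropy T U < ⊤ := by
  refine lt_of_le_of_lt (limsup_div_le_of_eventually_le (C := 0) (r := Real.log k)
    (Eventually.of_forall fun n => ?_)) (EReal.coe_lt_top _)
  obtain ⟨F, hF, -⟩ := exists_card_eq_coverNumber (T := T) hU n
  rw [zero_add, ← Real.log_pow]
  refine Real.log_le_log (by exact_mod_cast coverNumber_pos hU n) ?_
  rw [← hF]
  have := F.card_le_univ
  simp at this
  exact_mod_cast this

/-- An open cover of a zero-dimensional compact space has a locally constant selection. -/
lemma exists_clopen_selection {Y ι : Type*} [TopologicalSpace Y] [CompactSpace Y] [T2Space Y]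
    [TotallyDisconnectedSpace Y] [Finite ι] (Z : ι → Set Y) (hZ : ∀ i, IsOpen (Z i))
    (hcov : ∀ y, ∃ i, y ∈ Z i) :
    ∃ c : Y → ι, (∀ i, IsClopen (c ⁻¹' {i})) ∧ ∀ y, y ∈ Z (c y) := by
  classical
  choose i hi using hcov
  choose O hOc hyO hOZ using fun y => compact_exists_isClopen_in_isOpen (hZ (i y)) (hi y)
  obtain ⟨t, ht⟩ := isCompact_univ.elim_finite_subcover O (fun y => (hOc y).isOpen)
    fun y _ => mem_iUnion.2 ⟨y, hyO y⟩
  let D : ι → Set Y := fun j => ⋃ y ∈ t.filter (fun y => i y = j), O y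
  have hDc : ∀ j, IsClopen (D j) := fun j => isClopen_biUnion_finset fun y _ => hOc y
  have hDZ : ∀ j, D j ⊆ Z j := fun j => iUnion₂_subset fun y hy => by
    rw [Finset.mem_filter] at hy
    exact hy.2 ▸ hOZ y
  obtain ⟨C, hC, -, hCD, hDC, hdisj⟩ := exists_clopen_partition_of_clopen_cover
    (Z := fun _ : ι => (∅ : Set Y)) (fun _ => isClosed_empty) hDc (fun _ => empty_subset _)
    (fun _ _ _ _ _ => by simp)
  have hCcov : ∀ y, ∃ j, y ∈ C j := by
    intro y
    obtain ⟨z, hz, hyz⟩ := mem_iUnion₂.1 (ht (mem_univ y))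
    exact mem_iUnion.1 (hDC (mem_iUnion.2 ⟨i z, mem_iUnion₂.2
      ⟨z, Finset.mem_filter.2 ⟨hz, rfl⟩, hyz⟩⟩))
  choose c hc using hCcov
  refine ⟨c, fun j => ?_, fun y => hDZ _ (hCD _ (hc y))⟩
  convert! hC j using 1
  ext y
  simp only [mem_preimage, mem_singleton_iff]
  constructor
  · rintro rfl; exact hc y
  · intro hy
    by_contra hne
    exact disjoint_left.1 (hdisj (mem_univ _) (mem_univ _) hne) (hc y) hy

/-- A function which is constant with high probability has small entropy. -/
lemma exists_delta_entropy_le {ι : Type*} [Fintype ι] [DecidableEq ι] [MeasurableSpace ι]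
    [MeasurableSingletonClass ι] (i₀ : ι) {ε : ℝ} (hε : 0 < ε) :
    ∃ δ > 0, ∀ {Ω : Type*} [MeasurableSpace Ω] (μ : Measure Ω) [IsProbabilityMeasure μ]
      (η : Ω → ι), Measurable η → μ.real {x | η x ≠ i₀} ≤ δ → entropy μ η ≤ ε := by
  have hcard : (0 : ℝ) < Fintype.card ι := by
    exact_mod_cast Fintype.card_pos_iff.2 ⟨i₀⟩
  set e := ε / Fintype.card ι
  have he : 0 < e := by positivity
  have h0 : Tendsto Real.negMulLog (nhds 0) (nhds 0) := by
    simpa using Real.continuous_negMulLog.tendsto 0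
  obtain ⟨δ, hδ, h⟩ := Metric.eventually_nhds_iff.1 (h0.eventually_le_const he)
  refine ⟨min (δ / 2) e, by positivity, fun μ _ η hη hμ => ?_⟩
  have key : ∀ i, Real.negMulLog (μ.real (η ⁻¹' {i})) ≤ e := by
    intro i
    by_cases hi : i = i₀
    · subst hi
      refine (Real.negMulLog_le_one_sub_self measureReal_nonneg).trans ?_
      rw [← probReal_compl_eq_one_sub (hη (measurableSet_singleton i))]
      exact hμ.trans (min_le_right _ _)
    · have h1 : μ.real (η ⁻¹' {i}) ≤ δ / 2 := by
        refine (measureReal_mono ?_).trans (hμ.trans (min_le_left _ _))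
        intro x hx
        have : η x = i := hx
        simp [this, hi]
      refine h ?_
      rw [Real.dist_0_eq_abs, abs_of_nonneg measureReal_nonneg]
      linarith
  calc entropy μ η ≤ ∑ _i : ι, e := Finset.sum_le_sum fun i _ => key i
    _ = ε := by rw [Finset.sum_const, Finset.card_univ, nsmul_eq_mul, mul_div_cancel₀ _ hcard.ne']

/-- Partitions whose atoms are clopen. -/
def IsClopenPartition {Y : Type*} [TopologicalSpace Y] [MeasurableSpace Y] (α : FinPartition Y) :
    Prop := ∀ i, IsClopen (α.atom i)

/-! ### Measures of large entropy on zero-dimensional spaces -/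

section Zero

variable {Y : Type*} [TopologicalSpace Y] [CompactSpace Y] [TopologicalSpace.MetrizableSpace Y]
  [TotallyDisconnectedSpace Y] [MeasurableSpace Y] [BorelSpace Y]

/-- Inner regularity gives compact cores filling most of each atom. A clopen labelling that still
refines V and is correct on the cores differs from α on a set of small measure, so the error process
has small entropy per step. -/
lemma exists_clopenPartition_entropy_le {μ : Measure Y} [IsProbabilityMeasure μ] {S : Y → Y}
    (hS : MeasurePreserving S μ μ) {k : ℕ} {V : Fin k → Set Y} (hVo : ∀ i, IsOpen (V i))
    (hVc : (⋃ i, V i) = univ) {α : FinPartition Y} (hα : α ∈ refiningPartitions V) {ε : ℝ}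
    (hε : 0 < ε) : ∃ α' ∈ refiningPartitions V, IsClopenPartition α' ∧
      ∀ n : ℕ, entropy μ (itinerary S α'.label n) ≤ entropy μ (itinerary S α.label n) + n * ε := by
  classical
  choose f hf using hα
  let s := α.size
  let ι := Fin s ⊕ Fin k
  let _ : MeasurableSpace (Option (Fin (s + k))) := ⊤
  obtain ⟨δ, hδ, hent⟩ := exists_delta_entropy_le (none : Option (Fin (s + k))) hε
  have hδ' : ENNReal.ofReal (δ / (s + 1)) ≠ 0 := by
    rw [Ne, ENNReal.ofReal_eq_zero, not_le]; positivity
  choose K hKα hKc hKμ using fun i => (α.measurableSet_atom i).exists_isCompact_sdiff_lt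
    (measure_ne_top μ _) hδ'
  -- Only `Sum.inl i` is available on `K i`, so every selection is correct on the cores; the
  -- `Sum.inr` sets cover the remainder. Each member lies in some V j, which keeps the refinement.
  let Z : ι → Set Y := Sum.elim (fun i => V (f i) ∩ (⋃ j ∈ Finset.univ.erase i, K j)ᶜ)
    (fun j => V j ∩ (⋃ i, K i)ᶜ)
  have hZo : ∀ i, IsOpen (Z i) := by
    rintro (i | j)
    · exact (hVo _).inter (isClosed_biUnion_finset fun j _ => (hKc j).isClosed).isOpen_compl
    · exact (hVo _).inter (isClosed_iUnion_of_finite fun j => (hKc j).isClosed).isOpen_compl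
  have hKdisj : ∀ i j y, y ∈ K i → y ∈ K j → i = j := by
    intro i j y hi hj
    by_contra hne
    exact disjoint_left.1 (α.disjoint_atom i j hne) (hKα i hi) (hKα j hj)
  have hZc : ∀ y, ∃ i, y ∈ Z i := by
    intro y
    by_cases hy : ∃ i, y ∈ K i
    · obtain ⟨i, hi⟩ := hy
      refine ⟨Sum.inl i, hf i (hKα i hi), ?_⟩
      simp only [mem_compl_iff, mem_iUnion, not_exists, Finset.mem_erase]
      intro j hj hyj
      exact hj.1 (hKdisj _ _ y hyj hi)
    · obtain ⟨j, hj⟩ := mem_iUnion.1 (hVc ▸ mem_univ y)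
      exact ⟨Sum.inr j, hj, by simpa using hy⟩
  obtain ⟨c₀, hc₀, hc₀Z⟩ := exists_clopen_selection Z hZo hZc
  have hcK : ∀ i, ∀ y ∈ K i, c₀ y = Sum.inl i := by
    intro i y hy
    have := hc₀Z y
    rcases h : c₀ y with j | j
    · rw [h] at this
      by_contra hne
      refine this.2 (mem_biUnion (x := i) ?_ hy)
      simp only [Finset.coe_erase, Finset.coe_univ, Set.mem_sdiff, mem_univ, mem_singleton_iff,
        true_and]
      rintro rfl; exact hne rfl
    · rw [h] at this
      exact absurd (mem_iUnion.2 ⟨i, hy⟩) this.2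
  let c : Y → Fin (s + k) := fun y => finSumFinEquiv (c₀ y)
  have hcc : ∀ i, IsClopen (c ⁻¹' {i}) := by
    intro i
    convert! hc₀ (finSumFinEquiv.symm i) using 1
    ext y
    simp [c, Equiv.eq_symm_apply]
  have hcm : Measurable c := measurable_to_countable' fun i => (hcc i).isClosed.measurableSet
  -- Error symbol: `none` where c agrees with α, the value of c elsewhere. The names of α and η
  -- together determine that of c.
  let η : Y → Option (Fin (s + k)) := fun y =>
    if c y = finSumFinEquiv (Sum.inl (α.label y)) then none else some (c y)
  have hαm : Measurable fun y => (finSumFinEquiv (Sum.inl (α.label y)) : Fin (s + k)) :=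
    (measurable_of_finite fun i : Fin s => (finSumFinEquiv (Sum.inl i) : Fin (s + k))).comp
      α.measurable_label
  have hηm : Measurable η := Measurable.ite (measurableSet_eq_fun hcm hαm) measurable_const
    ((measurable_of_finite _).comp hcm)
  have hη : μ.real {y | η y ≠ none} ≤ δ := by
    have hsub : {y | η y ≠ none} ⊆ ⋃ i, α.atom i \ K i := by
      intro y hy
      refine mem_iUnion.2 ⟨α.label y, α.mem_atom_label y, fun hyK => hy ?_⟩
      simp [η, c, hcK _ y hyK]
    calc μ.real {y | η y ≠ none} ≤ μ.real (⋃ i, α.atom i \ K i) := measureReal_mono hsub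
      _ ≤ ∑ i, μ.real (α.atom i \ K i) := measureReal_iUnion_fintype_le _
      _ ≤ ∑ _i : Fin s, δ / (s + 1) := Finset.sum_le_sum fun i _ =>
          ENNReal.toReal_le_of_le_ofReal (by positivity) (hKμ i).le
      _ = s * (δ / (s + 1)) := by simp
      _ ≤ δ := by
          rw [← mul_div_assoc, div_le_iff₀ (by positivity)]; nlinarith
  refine ⟨FinPartition.ofFun c hcm, ?_, hcc, fun n => ?_⟩
  · intro a
    rcases h : finSumFinEquiv.symm a with i | j
    · refine ⟨f i, fun y hy => ?_⟩
      have h1 : c y = a := hy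
      have h2 : c₀ y = Sum.inl i := by rw [← h, ← h1, Equiv.symm_apply_apply]
      have := hc₀Z y
      rw [h2] at this
      exact this.1
    · refine ⟨j, fun y hy => ?_⟩
      have h1 : c y = a := hy
      have h2 : c₀ y = Sum.inr j := by rw [← h, ← h1, Equiv.symm_apply_apply]
      have := hc₀Z y
      rw [h2] at this
      exact this.1
  · rw [FinPartition.label_ofFun]
    have hSm := hS.measurable
    have hα' := measurable_itinerary hSm α.measurable_label n
    have hη' := measurable_itinerary hSm hηm n
    have h1 : entropy μ (itinerary S c n) ≤
        entropy μ (fun x => (itinerary S α.label n x, itinerary S η n x)) := by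
      refine entropy_le_of_factor μ (hα'.prodMk hη')
        (fun p j => (p.2 j).getD (finSumFinEquiv (Sum.inl (p.1 j)))) fun x => ?_
      funext j
      simp only [itinerary, η]
      split_ifs with h
      · simpa using h
      · simp
    have h2 := entropy_prodMk_le μ hα' hη'
    have h3 := entropy_itinerary_le hS hηm n
    have h4 : (n : ℝ) * entropy μ η ≤ n * ε := by gcongr; exact hent μ η hηm hη
    exact h1.trans (by linarith)

lemma probabilityMeasure_ext_clopen {μ ν : ProbabilityMeasure Y}
    (h : ∀ C, IsClopen C → (μ : Measure Y).real C = (ν : Measure Y).real C) : μ = ν := by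
  have : SecondCountableTopology Y := by
    let _ := TopologicalSpace.metrizableSpaceMetric Y; infer_instance
  refine ProbabilityMeasure.toMeasure_injective
    (ext_of_generate_finite {C | IsClopen C} ?_ ?_ ?_ (by simp))
  · rw [BorelSpace.measurable_eq (α := Y)]
    exact isTopologicalBasis_isClopen.borel_eq_generateFrom
  · intro A hA B hB _
    exact IsClopen.inter hA hB
  · intro C hC
    exact (measureReal_eq_measureReal_iff).1 (h C hC)

lemma continuous_measureReal_clopen {C : Set Y} (hC : IsClopen C) :
    Continuous fun μ : ProbabilityMeasure Y => (μ : Measure Y).real C := by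
  rw [continuous_iff_continuousAt]
  intro μ
  have := ProbabilityMeasure.tendsto_measure_of_isClopen_of_tendsto (tendsto_id (x := nhds μ)) hC
  have h2 := (NNReal.continuous_coe.tendsto _).comp this
  simpa [ContinuousAt, Function.comp_def] using h2

lemma isClopen_preimage_itinerary {S : Y → Y} (hS : Continuous S) {α : FinPartition Y}
    (hα : IsClopenPartition α) (m : ℕ) (w : Fin m → Fin α.size) :
    IsClopen (itinerary S α.label m ⁻¹' {w}) := by
  rw [← wordSet_atom]
  exact isClopen_iInter_of_finite fun j => (hα _).preimage (hS.iterate _)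

lemma continuous_entropy_itinerary {S : Y → Y} (hS : Continuous S) {α : FinPartition Y}
    (hα : IsClopenPartition α) (m : ℕ) :
    Continuous fun μ : ProbabilityMeasure Y => entropy (μ : Measure Y) (itinerary S α.label m) :=
  continuous_finsetSum _ fun w _ => Real.continuous_negMulLog.comp
    (continuous_measureReal_clopen (isClopen_preimage_itinerary hS hα m w))

lemma mem_invariantMeasures_iff_clopen {S : Y → Y} (hS : Continuous S) {μ : ProbabilityMeasure Y} :
    μ ∈ invariantMeasures S ↔ ∀ C, IsClopen C →
      (μ : Measure Y).real (S ⁻¹' C) = (μ : Measure Y).real C := by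
  constructor
  · intro h C hC
    exact congrArg ENNReal.toReal
      (MeasurePreserving.measure_preimage h hC.isClosed.measurableSet.nullMeasurableSet)
  · intro h
    refine ⟨hS.measurable, ?_⟩
    have := probabilityMeasure_ext_clopen (μ := μ.map hS.measurable.aemeasurable) (ν := μ)
      fun C hC => by
        rw [ProbabilityMeasure.toMeasure_map, measureReal_def,
          Measure.map_apply hS.measurable hC.isClosed.measurableSet]
        exact h C hC
    simpa using congrArg ((↑) : ProbabilityMeasure Y → Measure Y) this

lemma isClosed_invariantMeasures {S : Y → Y} (hS : Continuous S) :
    IsClosed (invariantMeasures S) := by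
  have : invariantMeasures S = ⋂ C : {C : Set Y // IsClopen C},
      {μ : ProbabilityMeasure Y | (μ : Measure Y).real (S ⁻¹' C) = (μ : Measure Y).real C} := by
    ext μ
    rw [mem_invariantMeasures_iff_clopen hS]
    simp
  rw [this]
  exact isClosed_iInter fun C => isClosed_eq
    (continuous_measureReal_clopen (C.2.preimage hS)) (continuous_measureReal_clopen C.2)

/-- Invariant measures for which finitely many clopen partitions have large entropy. -/
lemma exists_invariant_entropy_ge [Nonempty Y] {S : Y → Y} (hS : Continuous S) {k : ℕ}
    {V : Fin k → Set Y} (hVc : (⋃ i, V i) = univ) {J : Type*} (s : Finset J) (hs : s.Nonempty)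
    (A : J → FinPartition Y) (hA : ∀ l, A l ∈ refiningPartitions V)
    (hAc : ∀ l, IsClopenPartition (A l)) {r : ℝ} (hr : (r : EReal) < topEntropy S V) :
    ∃ μ ∈ invariantMeasures S, ∀ l ∈ s, ∀ m : ℕ,
      m * r ≤ entropy (μ : Measure Y) (itinerary S (A l).label m) := by
  have hfreq : ∃ᶠ n : ℕ in atTop, n * r ≤ Real.log (coverNumber S V n) ∧ n ≠ 0 := by
    have h1 : ∃ᶠ n : ℕ in atTop,
        (r : EReal) < ((Real.log (coverNumber S V n) / n : ℝ) : EReal) :=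
      frequently_lt_of_lt_limsup (by isBoundedDefault) hr
    refine (h1.and_eventually (eventually_ne_atTop 0)).mono fun n hn => ⟨?_, hn.2⟩
    have h2 : r < Real.log (coverNumber S V n) / n := by exact_mod_cast hn.1
    have hn' : (0 : ℝ) < n := by
      have := hn.2; positivity
    rw [lt_div_iff₀ hn'] at h2
    linarith
  set E : Set ℕ := {n | n * r ≤ Real.log (coverNumber S V n) ∧ n ≠ 0}
  have hne : (atTop ⊓ 𝓟 E).NeBot := frequently_mem_iff_neBot.1 hfreq
  have hex := fun n : ℕ => exists_almost_invariant_measure (n := n + 1) hS.measurable hVc s hs A hA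
    (Nat.succ_ne_zero n)
  choose μs₀ h1 h2 using hex
  -- The averages were built for length n + 1 to avoid length 0; the shift restores index n, and E
  -- excludes n = 0.
  let μs : ℕ → ProbabilityMeasure Y := fun n => μs₀ (n - 1)
  let u : Ultrafilter ℕ := Ultrafilter.of (atTop ⊓ 𝓟 E)
  have hu : (u : Filter ℕ) ≤ atTop ⊓ 𝓟 E := Ultrafilter.of_le _
  have huat : Tendsto id (u : Filter ℕ) atTop := hu.trans inf_le_left
  have huE : ∀ᶠ n in (u : Filter ℕ), n ∈ E := hu (mem_inf_of_right (mem_principal_self E))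
  obtain ⟨μ, -, hμ⟩ := isCompact_univ.ultrafilter_le_nhds (u.map μs) (by simp)
  have hμ' : Tendsto μs u (nhds μ) := hμ
  have hinv : ∀ a : ℝ, Tendsto (fun n : ℕ => a / n) (u : Filter ℕ) (nhds 0) := fun a =>
    (tendsto_const_div_atTop_nhds_zero_nat a).comp huat
  refine ⟨μ, (mem_invariantMeasures_iff_clopen hS).2 fun C hC => ?_, fun l hl m => ?_⟩
  · have t1 := ((continuous_measureReal_clopen (hC.preimage hS)).tendsto μ).comp hμ'
    have t2 := ((continuous_measureReal_clopen hC).tendsto μ).comp hμ'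
    have t3 := (t1.sub t2).abs
    have t4 : |(μ : Measure Y).real (S ⁻¹' C) - (μ : Measure Y).real C| ≤ 0 := by
      refine le_of_tendsto_of_tendsto t3 (hinv 1) ?_
      filter_upwards [huE] with n hn
      have := h1 (n - 1) C hC.isClosed.measurableSet
      rwa [Nat.sub_add_cancel (Nat.one_le_iff_ne_zero.2 hn.2)] at this
    exact sub_eq_zero.1 (abs_nonpos_iff.1 t4)
  · rcases eq_or_ne m 0 with rfl | hm
    · simpa using entropy_nonneg _ _
    -- All errors that do not grow with n; dividing by n removes them in the limit.
    set a : ℝ := m * Real.log s.card + 2 * m ^ 2 * Real.log (A l).size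
    have t1 := (((continuous_entropy_itinerary hS (hAc l) m).tendsto μ).comp hμ').add (hinv a)
    rw [add_zero] at t1
    refine ge_of_tendsto t1 ?_
    filter_upwards [huE] with n hn
    have hn0 : (0 : ℝ) < n := by have := hn.2; positivity
    have h3 := h2 (n - 1) l hl m hm
    rw [Nat.sub_add_cancel (Nat.one_le_iff_ne_zero.2 hn.2)] at h3
    have h4 : (m : ℝ) * (n * r) ≤ m * Real.log (coverNumber S V n) := by gcongr; exact hn.1
    simp only [Function.comp]
    rw [← sub_le_iff_le_add, ← mul_le_mul_iff_right₀ hn0, mul_sub, mul_div_cancel₀ _ hn0.ne']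
    simp only [a, μs]
    linarith

/-- The invariant measures for which every clopen partition refining `V` has entropy at least the
topological entropy of `V`. -/
def largeEntropyMeasures (S : Y → Y) {k : ℕ} (V : Fin k → Set Y) : Set (ProbabilityMeasure Y) :=
  {μ | μ ∈ invariantMeasures S ∧ ∀ α ∈ refiningPartitions V, IsClopenPartition α →
    topEntropy S V ≤ measureEntropy S (μ : Measure Y) α}

/-- Constraints cutting out the measures of large entropy. -/
structure EntropyConstraint (S : Y → Y) {k : ℕ} (V : Fin k → Set Y) where
  part : FinPartition Y
  refines : part ∈ refiningPartitions V
  clopen : IsClopenPartition part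
  rate : ℝ
  rate_lt : (rate : EReal) < topEntropy S V

/-- The measures satisfying a constraint. -/
def EntropyConstraint.solutions {S : Y → Y} {k : ℕ} {V : Fin k → Set Y}
    (e : EntropyConstraint S V) : Set (ProbabilityMeasure Y) :=
  ⋂ m : ℕ, {μ | m * e.rate ≤ entropy (μ : Measure Y) (itinerary S e.part.label m)}

lemma EntropyConstraint.isClosed_solutions {S : Y → Y} (hS : Continuous S) {k : ℕ}
    {V : Fin k → Set Y} (e : EntropyConstraint S V) : IsClosed e.solutions :=
  isClosed_iInter fun m => isClosed_le continuous_const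
    (continuous_entropy_itinerary hS e.clopen m)

/-- Since h_μ(α) = inf H_m / m, a lower bound on it is a family of inequalities, one for each m, and
these are closed conditions when α is clopen. -/
lemma largeEntropyMeasures_eq (S : Y → Y) {k : ℕ} (V : Fin k → Set Y) :
    largeEntropyMeasures S V =
      invariantMeasures S ∩ ⋂ e : EntropyConstraint S V, e.solutions := by
  ext μ
  simp only [largeEntropyMeasures, EntropyConstraint.solutions, mem_inter_iff, mem_iInter]
  refine and_congr_right fun hμ => ⟨fun h e m => ?_, fun h α hα hαc => ?_⟩
  · exact mul_le_entropy_of_le_measureEntropy hμ (e.rate_lt.le.trans (h _ e.refines e.clopen)) m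
  · refine EReal.ge_of_forall_gt_iff_ge.1 fun r hr => ?_
    exact le_measureEntropy fun m => h ⟨α, hα, hαc, r, hr⟩ m

lemma isCompact_largeEntropyMeasures {S : Y → Y} (hS : Continuous S) {k : ℕ}
    (V : Fin k → Set Y) : IsCompact (largeEntropyMeasures S V) := by
  rw [largeEntropyMeasures_eq]
  exact ((isClosed_invariantMeasures hS).inter
    (isClosed_iInter fun e => e.isClosed_solutions hS)).isCompact

lemma largeEntropyMeasures_nonempty [Nonempty Y] {S : Y → Y} (hS : Continuous S) {k : ℕ}
    {V : Fin k → Set Y} (hVo : ∀ i, IsOpen (V i)) (hVc : (⋃ i, V i) = univ) :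
    (largeEntropyMeasures S V).Nonempty := by
  classical
  rw [largeEntropyMeasures_eq]
  refine (isClosed_invariantMeasures hS).isCompact.inter_iInter_nonempty _
    (fun e => e.isClosed_solutions hS) fun u => ?_
  obtain ⟨c, hcc, hcV⟩ := exists_clopen_selection V hVo fun y => mem_iUnion.1 (hVc ▸ mem_univ y)
  have hcm : Measurable c := measurable_to_countable' fun i => (hcc i).isClosed.measurableSet
  have hlt : ((-1 : ℝ) : EReal) < topEntropy S V :=
    lt_of_lt_of_le (by exact_mod_cast neg_one_lt_zero) topEntropy_nonneg
  -- A harmless constraint, needed because the given finite family may be empty.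
  let e₀ : EntropyConstraint S V := ⟨FinPartition.ofFun c hcm,
    fun a => ⟨a, fun y hy => by have : c y = a := hy; exact this ▸ hcV y⟩, hcc, -1, hlt⟩
  let u' := insert e₀ u
  have hu' : u'.Nonempty := Finset.insert_nonempty _ _
  -- The largest rate is still below the topological entropy and serves all the constraints.
  obtain ⟨e₁, he₁, hmax⟩ := u'.exists_max_image (fun e => e.rate) hu'
  obtain ⟨μ, hμ, h⟩ := exists_invariant_entropy_ge hS hVc u' hu' (fun e => e.part)
    (fun e => e.refines) (fun e => e.clopen) e₁.rate_lt
  refine ⟨μ, hμ, ?_⟩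
  simp only [mem_iInter]
  intro e he
  simp only [EntropyConstraint.solutions, mem_iInter]
  intro m
  have he' : e ∈ u' := Finset.mem_insert_of_mem he
  refine le_trans ?_ (h e he' m)
  gcongr
  exact hmax e he'

lemma topEntropy_le_of_mem_largeEntropyMeasures {S : Y → Y} {k : ℕ} {V : Fin k → Set Y}
    (hVo : ∀ i, IsOpen (V i)) (hVc : (⋃ i, V i) = univ) {μ : ProbabilityMeasure Y}
    (hμ : μ ∈ largeEntropyMeasures S V) {α : FinPartition Y} (hα : α ∈ refiningPartitions V) :
    topEntropy S V ≤ measureEntropy S (μ : Measure Y) α := by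
  refine EReal.ge_of_forall_gt_iff_ge.1 fun r hr => ?_
  obtain ⟨r₁, hr₁, hr₁'⟩ := EReal.exists_between_coe_real hr
  have hlt : r < r₁ := by exact_mod_cast hr₁
  obtain ⟨α', hα', hcl, h⟩ := exists_clopenPartition_entropy_le hμ.1 hVo hVc hα (sub_pos.2 hlt)
  refine le_measureEntropy fun m => ?_
  have h1 := mul_le_entropy_of_le_measureEntropy hμ.1 (hr₁'.le.trans (hμ.2 α' hα' hcl)) m
  have h2 := h m
  linarith

end Zero

/-! ### Conditioning on invariant sets -/

section Conditional

variable {X : Type*} [MeasurableSpace X] {μ : Measure X} [IsProbabilityMeasure μ]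

lemma measureReal_inter_eq_mul_cond {A : Set X} (hA : MeasurableSet A) (s : Set X) :
    μ.real (A ∩ s) = μ.real A * (μ[|A]).real s := by
  rw [measureReal_def, measureReal_def, measureReal_def, ← ENNReal.toReal_mul, mul_comm,
    cond_mul_eq_inter hA]

lemma measurePreserving_cond {T : X → X} (hT : MeasurePreserving T μ μ) {A : Set X}
    (hA : MeasurableSet A) (hTA : T ⁻¹' A = A) : MeasurePreserving T (μ[|A]) (μ[|A]) := by
  refine ⟨hT.measurable, Measure.ext fun s hs => ?_⟩
  rw [Measure.map_apply hT.measurable hs, cond_apply hA, cond_apply hA]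
  congr 1
  conv_lhs => rw [← hTA, ← preimage_inter]
  exact hT.measure_preimage (hA.inter hs).nullMeasurableSet

/-- Chain rule for the two-set partition by A. The overhead depends only on μ(A), so it disappears
from entropy rates. -/
lemma entropy_glue {ι κ : Type*} [Fintype ι] [Fintype κ] {A : Set X} [DecidablePred (· ∈ A)]
    (hA : MeasurableSet A) (hA0 : μ A ≠ 0) (hA1 : μ Aᶜ ≠ 0)
    [MeasurableSpace ι] [MeasurableSingletonClass ι] [MeasurableSpace κ]
    [MeasurableSingletonClass κ] {f : X → ι} {g : X → κ} (hf : Measurable f) (hg : Measurable g) :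
    entropy μ (fun x => if x ∈ A then (Sum.inl (f x) : ι ⊕ κ) else Sum.inr (g x)) =
      Real.negMulLog (μ.real A) + μ.real A * entropy (μ[|A]) f +
        (Real.negMulLog (μ.real Aᶜ) + μ.real Aᶜ * entropy (μ[|Aᶜ]) g) := by
  have := cond_isProbabilityMeasure hA0
  have := cond_isProbabilityMeasure hA1
  have h1 : ∀ i, (fun x => if x ∈ A then (Sum.inl (f x) : ι ⊕ κ) else Sum.inr (g x)) ⁻¹'
      {Sum.inl i} = A ∩ f ⁻¹' {i} := by
    intro i; ext x; by_cases hx : x ∈ A <;> simp [hx]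
  have h2 : ∀ i, (fun x => if x ∈ A then (Sum.inl (f x) : ι ⊕ κ) else Sum.inr (g x)) ⁻¹'
      {Sum.inr i} = Aᶜ ∩ g ⁻¹' {i} := by
    intro i; ext x; by_cases hx : x ∈ A <;> simp [hx]
  have hsf := sum_measureReal_preimage (μ[|A]) hf
  have hsg := sum_measureReal_preimage (μ[|Aᶜ]) hg
  rw [entropy, Fintype.sum_sum_type]
  simp only [h1, h2, measureReal_inter_eq_mul_cond hA, measureReal_inter_eq_mul_cond hA.compl,
    Real.negMulLog_mul, Finset.sum_add_distrib, ← Finset.sum_mul, ← Finset.mul_sum, hsf, hsg,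
    one_mul]
  rfl

end Conditional

section Face

variable {X : Type*} [TopologicalSpace X] [T2Space X] [SecondCountableTopology X]
  [MeasurableSpace X] [BorelSpace X]

/-- Conditioning on an invariant set preserves maximality of the entropy relative to a cover. -/
lemma topEntropy_le_measureEntropy_cond [Nonempty X] (T : X ≃ₜ X) {k : ℕ} {U : Fin k → Set X}
    (hUo : ∀ i, IsOpen (U i)) (hUc : (⋃ i, U i) = univ) {μ : Measure X} [IsProbabilityMeasure μ]
    (hμ : ∀ α ∈ refiningPartitions U, topEntropy T U ≤ measureEntropy T μ α)
    {A : Set X} (hA : MeasurableSet A) (hTA : T ⁻¹' A = A) (hA0 : μ A ≠ 0) (hA1 : μ Aᶜ ≠ 0)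
    {α : FinPartition X} (hα : α ∈ refiningPartitions U) :
    topEntropy T U ≤ measureEntropy T (μ[|A]) α := by
  classical
  by_contra! hlt
  have := cond_isProbabilityMeasure hA0
  have := cond_isProbabilityMeasure hA1
  have hTm := T.continuous.measurable
  obtain ⟨h, hh⟩ : ∃ h : ℝ, topEntropy T U = h :=
    ⟨_, (EReal.coe_toReal (topEntropy_lt_top T hUc).ne
      (lt_of_lt_of_le EReal.bot_lt_zero topEntropy_nonneg).ne').symm⟩
  set t := μ.real A
  have ht : 0 < t := ENNReal.toReal_pos hA0 (measure_ne_top μ A)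
  have ht' : 0 < μ.real Aᶜ := ENNReal.toReal_pos hA1 (measure_ne_top μ _)
  have htc : μ.real Aᶜ = 1 - t := probReal_compl_eq_one_sub hA
  rw [htc] at ht'
  obtain ⟨r₁, hr₁, hr₁'⟩ := EReal.exists_between_coe_real hlt
  rw [hh] at hr₁'
  have hr₁h : r₁ < h := by exact_mod_cast hr₁'
  -- d is the entropy saved on A if the claim fails. A universal partition β loses at most 3d/4 on
  -- the complement, so gluing α on A to β off A gives a refining partition of entropy below h.
  set d := t * (h - r₁)
  have hd : 0 < d := mul_pos ht (sub_pos.2 hr₁h)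
  obtain ⟨β, hβ, hβe⟩ := exists_refining_partition_entropy_le T U hUo hUc
    (r' := h + d / 2) (by rw [hh]; exact_mod_cast (by linarith : h < h + d / 2))
  have hβe' : measureEntropy T (μ[|Aᶜ]) β < ((h + d * (3 / 4) : ℝ) : EReal) :=
    (hβe _ inferInstance).trans_lt (by exact_mod_cast (by linarith : h + d / 2 < h + d * (3 / 4)))
  let c : X → Fin (α.size + β.size) := fun x =>
    if x ∈ A then finSumFinEquiv (Sum.inl (α.label x)) else finSumFinEquiv (Sum.inr (β.label x))
  have hcm : Measurable c := Measurable.ite hA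
    ((measurable_of_finite fun i => (finSumFinEquiv (Sum.inl i) : Fin (α.size + β.size))).comp
      α.measurable_label)
    ((measurable_of_finite fun i => (finSumFinEquiv (Sum.inr i) : Fin (α.size + β.size))).comp
      β.measurable_label)
  have hγ : FinPartition.ofFun c hcm ∈ refiningPartitions U := by
    obtain ⟨f, hf⟩ := FinPartition.label_spec hα
    obtain ⟨g, hg⟩ := FinPartition.label_spec hβ
    intro a
    refine ⟨Sum.elim f g (finSumFinEquiv.symm a), fun x hx => ?_⟩
    have hx' : c x = a := hx
    rw [← hx']
    by_cases hxA : x ∈ A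
    · simp only [c, hxA, if_true, Equiv.symm_apply_apply, Sum.elim_inl]; exact hf x
    · simp only [c, hxA, if_false, Equiv.symm_apply_apply, Sum.elim_inr]; exact hg x
  have hTn : ∀ n x, T^[n] x ∈ A ↔ x ∈ A := by
    intro n
    induction n with
    | zero => simp
    | succ n ih =>
      intro x
      rw [Function.iterate_succ_apply, ih, ← mem_preimage, hTA]
  have hbound : ∀ n, entropy μ (itinerary T c n) ≤
      Real.negMulLog t + t * entropy (μ[|A]) (itinerary T α.label n) +
        (Real.negMulLog (1 - t) + (1 - t) * entropy (μ[|Aᶜ]) (itinerary T β.label n)) := by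
    intro n
    have hfm := measurable_itinerary hTm α.measurable_label n
    have hgm := measurable_itinerary hTm β.measurable_label n
    rw [← htc, ← entropy_glue hA hA0 hA1 hfm hgm]
    let _ : MeasurableSpace ((Fin n → Fin α.size) ⊕ (Fin n → Fin β.size)) := ⊤
    refine entropy_le_of_factor μ (Measurable.ite hA ((measurable_of_finite _).comp hfm)
      ((measurable_of_finite _).comp hgm))
      (Sum.elim (fun w j => finSumFinEquiv (Sum.inl (w j)))
        (fun w j => finSumFinEquiv (Sum.inr (w j)))) fun x => ?_
    funext j
    by_cases hxA : x ∈ A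
    · simp [itinerary, c, hTn, hxA]
    · simp [itinerary, c, hTn, hxA]
  have hle : measureEntropy T μ (FinPartition.ofFun c hcm) ≤
      ((t * r₁ + (1 - t) * (h + d * (3 / 4)) : ℝ) : EReal) := by
    refine limsup_div_le_of_eventually_le
      (C := Real.negMulLog t + Real.negMulLog (1 - t)) ?_
    filter_upwards [eventually_entropy_le hr₁, eventually_entropy_le hβe'] with n h1 h2
    rw [shannonEntropy_ofFun]
    refine (hbound n).trans ?_
    have h3 := mul_le_mul_of_nonneg_left h1 ht.le
    have h4 := mul_le_mul_of_nonneg_left h2 ht'.le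
    linarith
  have hfin := (hμ _ hγ).trans hle
  rw [hh] at hfin
  have hfin' : h ≤ t * r₁ + (1 - t) * (h + d * (3 / 4)) := by exact_mod_cast hfin
  have : (1 - t) * d ≤ d := by nlinarith
  simp only [d] at *
  nlinarith

end Face

/-! ### An ergodic measure by strict convexity -/

section Ergodic

variable {Y : Type*} [TopologicalSpace Y] [CompactSpace Y] [TopologicalSpace.MetrizableSpace Y]
  [TotallyDisconnectedSpace Y] [MeasurableSpace Y] [BorelSpace Y]

/-- A continuous strictly convex functional on probability measures of a zero-dimensional
space. -/
lemma exists_strictConvex_functional :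
    ∃ Φ : ProbabilityMeasure Y → ℝ, Continuous Φ ∧
      ∀ (μ μ₁ μ₂ : ProbabilityMeasure Y) (t : ℝ), 0 < t → t < 1 →
        (∀ C, IsClopen C → (μ : Measure Y).real C =
          t * (μ₁ : Measure Y).real C + (1 - t) * (μ₂ : Measure Y).real C) →
        Φ μ₁ ≤ Φ μ → Φ μ₂ ≤ Φ μ → μ₁ = μ₂ := by
  have : SecondCountableTopology Y := by
    let _ := TopologicalSpace.metrizableSpaceMetric Y; infer_instance
  have : Countable (TopologicalSpace.Clopens Y) :=
    TopologicalSpace.Clopens.countable_iff_secondCountable.2 inferInstance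
  obtain ⟨C, hC⟩ := exists_surjective_nat (TopologicalSpace.Clopens Y)
  -- Φ(μ) = ∑ 2^{-i} μ(C_i)² over all clopen sets; strictness comes from ta² + (1-t)b² - (ta +
  -- (1-t)b)² = t(1-t)(a-b)².
  let F : ℕ → ProbabilityMeasure Y → ℝ := fun i μ =>
    (1 / 2) ^ i * (μ : Measure Y).real (C i) ^ 2
  have hFle : ∀ i μ, ‖F i μ‖ ≤ (1 / 2 : ℝ) ^ i := by
    intro i μ
    have h1 := measureReal_nonneg (μ := (μ : Measure Y)) (s := C i)
    have h2 := measureReal_le_one (μ := (μ : Measure Y)) (s := C i)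
    rw [Real.norm_of_nonneg (by positivity)]
    exact mul_le_of_le_one_right (by positivity) (pow_le_one₀ h1 h2)
  have hsum : ∀ μ, Summable fun i => F i μ := fun μ =>
    Summable.of_norm_bounded summable_geometric_two fun i => hFle i μ
  refine ⟨fun μ => ∑' i, F i μ, ?_, ?_⟩
  · refine continuous_tsum (fun i => ?_) summable_geometric_two hFle
    exact continuous_const.mul ((continuous_measureReal_clopen (C i).isClopen).pow 2)
  · intro μ μ₁ μ₂ t ht0 ht1 hμ h1 h2
    have hs := (((hsum μ₁).hasSum.mul_left t).add ((hsum μ₂).hasSum.mul_left (1 - t))).sub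
      (hsum μ).hasSum
    have hterm : ∀ i, t * F i μ₁ + (1 - t) * F i μ₂ - F i μ = (1 / 2) ^ i * (t * (1 - t)) *
        ((μ₁ : Measure Y).real (C i) - (μ₂ : Measure Y).real (C i)) ^ 2 := by
      intro i
      simp only [F, hμ _ (C i).isClopen]
      ring
    have hpos : 0 < t * (1 - t) := mul_pos ht0 (sub_pos.2 ht1)
    have hnn : ∀ i, 0 ≤ t * F i μ₁ + (1 - t) * F i μ₂ - F i μ := by
      intro i; rw [hterm]; positivity
    refine probabilityMeasure_ext_clopen fun D hD => ?_
    obtain ⟨i, hi⟩ := hC ⟨D, hD⟩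
    have hle := le_hasSum hs i fun j _ => hnn j
    rw [hterm] at hle
    have hle' : (1 / 2 : ℝ) ^ i * (t * (1 - t)) *
        ((μ₁ : Measure Y).real (C i) - (μ₂ : Measure Y).real (C i)) ^ 2 ≤ 0 := by
      refine hle.trans ?_
      nlinarith
    have hsq := nonpos_of_mul_nonpos_right hle' (by positivity)
    have := pow_eq_zero_iff two_ne_zero |>.1 (le_antisymm hsq (sq_nonneg _))
    rw [hi] at this
    exact sub_eq_zero.1 this

/-- At a maximizer of Φ, a nontrivial invariant set A would write μ as a proper convex combination
of its two conditional measures. Both have large entropy, so strict convexity makes them equal, yet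
they differ on A. -/
lemma exists_ergodic_of_totallyDisconnected [Nonempty Y] (S : Y ≃ₜ Y) {k : ℕ}
    {V : Fin k → Set Y} (hVo : ∀ i, IsOpen (V i)) (hVc : (⋃ i, V i) = univ) :
    ∃ μ ∈ invariantMeasures S, Ergodic S (μ : Measure Y) ∧
      ∀ α ∈ refiningPartitions V, topEntropy S V ≤ measureEntropy S (μ : Measure Y) α := by
  have : SecondCountableTopology Y := by
    let _ := TopologicalSpace.metrizableSpaceMetric Y; infer_instance
  obtain ⟨Φ, hΦ, hconv⟩ := exists_strictConvex_functional (Y := Y)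
  obtain ⟨μ, hμ, hmax⟩ := (isCompact_largeEntropyMeasures S.continuous V).exists_isMaxOn
    (largeEntropyMeasures_nonempty S.continuous hVo hVc) hΦ.continuousOn
  have hinv : MeasurePreserving S (μ : Measure Y) μ := hμ.1
  have hent : ∀ α ∈ refiningPartitions V, topEntropy S V ≤ measureEntropy S (μ : Measure Y) α :=
    fun α hα => topEntropy_le_of_mem_largeEntropyMeasures hVo hVc hμ hα
  refine ⟨μ, hμ.1, ⟨hinv, ⟨fun A hA hSA => ?_⟩⟩, hent⟩
  by_contra hconst
  have hA0 : (μ : Measure Y) A ≠ 0 := fun h => hconst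
    (eventuallyConst_set'.2 (Or.inl (ae_eq_empty.2 h)))
  have hA1 : (μ : Measure Y) Aᶜ ≠ 0 := fun h => hconst
    (eventuallyConst_set'.2 (Or.inr (ae_eq_univ.2 h)))
  have hSA' : S ⁻¹' Aᶜ = Aᶜ := by rw [preimage_compl, hSA]
  let μ₁ : ProbabilityMeasure Y := ⟨(μ : Measure Y)[|A], cond_isProbabilityMeasure hA0⟩
  let μ₂ : ProbabilityMeasure Y := ⟨(μ : Measure Y)[|Aᶜ], cond_isProbabilityMeasure hA1⟩
  have h1 : μ₁ ∈ largeEntropyMeasures S V := ⟨measurePreserving_cond hinv hA hSA,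
    fun α hα _ => topEntropy_le_measureEntropy_cond S hVo hVc hent hA hSA hA0 hA1 hα⟩
  have h2 : μ₂ ∈ largeEntropyMeasures S V := ⟨measurePreserving_cond hinv hA.compl hSA',
    fun α hα _ => topEntropy_le_measureEntropy_cond S hVo hVc hent hA.compl hSA' hA1
      (by rwa [compl_compl]) hα⟩
  have htc : (μ : Measure Y).real Aᶜ = 1 - (μ : Measure Y).real A := probReal_compl_eq_one_sub hA
  have ht0 : 0 < (μ : Measure Y).real A := ENNReal.toReal_pos hA0 (measure_ne_top _ _)
  have ht1 : 0 < (μ : Measure Y).real Aᶜ := ENNReal.toReal_pos hA1 (measure_ne_top _ _)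
  have heq : μ₁ = μ₂ := by
    refine hconv μ μ₁ μ₂ _ ht0 (by linarith) (fun C hC => ?_) (hmax h1) (hmax h2)
    rw [← htc]
    simp only [μ₁, μ₂, ProbabilityMeasure.coe_mk]
    rw [← measureReal_inter_eq_mul_cond hA, ← measureReal_inter_eq_mul_cond hA.compl,
      inter_comm, inter_comm Aᶜ, ← Set.sdiff_eq, measureReal_inter_add_sdiff hA]
  have e1 : (μ₁ : Measure Y) A = 1 := cond_apply_self hA0 (measure_ne_top _ _)
  have e2 : (μ₂ : Measure Y) A = 0 := by
    simp only [μ₂, ProbabilityMeasure.coe_mk]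
    rw [cond_apply hA.compl, compl_inter_self, measure_empty, mul_zero]
  rw [heq, e2] at e1
  exact zero_ne_one e1

end Ergodic

/-! ### Zero-dimensional extensions and factors -/

section Extension

variable {X : Type*} [TopologicalSpace X] [CompactSpace X] [TopologicalSpace.MetrizableSpace X]

/-- Bi-infinite sequences in the Cantor set lying over an orbit of `T`. -/
def orbitExtension (T : X → X) (p : (ℕ → Bool) → X) : Set (ℤ → ℕ → Bool) :=
  {y | ∀ n, p (y (n + 1)) = T (p (y n))}

/-- The shift on the orbit extension. -/
def orbitShift (T : X → X) (p : (ℕ → Bool) → X) : orbitExtension T p ≃ₜ orbitExtension T p where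
  toFun y := ⟨fun n => y.1 (n + 1), fun n => y.2 (n + 1)⟩
  invFun y := ⟨fun n => y.1 (n - 1), fun n => by
    have := y.2 (n - 1)
    rw [sub_add_cancel] at this
    simpa using this⟩
  left_inv y := by ext; simp
  right_inv y := by ext; simp
  continuous_toFun := by
    refine Continuous.subtype_mk (continuous_pi fun n => ?_) _
    exact (continuous_apply (n + 1)).comp continuous_subtype_val
  continuous_invFun := by
    refine Continuous.subtype_mk (continuous_pi fun n => ?_) _
    exact (continuous_apply (n - 1)).comp continuous_subtype_val

/-- Every system on a compact metrizable space is a factor of a zero-dimensional one. -/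
lemma exists_zeroDimensional_extension [Nonempty X] (T : X ≃ₜ X) :
    ∃ (Y : Type) (_ : TopologicalSpace Y) (_ : CompactSpace Y)
      (_ : TopologicalSpace.MetrizableSpace Y) (_ : TotallyDisconnectedSpace Y) (S : Y ≃ₜ Y)
      (π : Y → X), Continuous π ∧ Function.Surjective π ∧ Function.Semiconj π S T := by
  let _ := TopologicalSpace.metrizableSpaceMetric X
  -- T need not lift to the Cantor set through p, so the extension records a lift of every point of
  -- the orbit. Two-sided sequences make the shift invertible.
  obtain ⟨p, hp, hps⟩ := exists_nat_bool_continuous_surjective_of_compact X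
  have hcl : IsClosed (orbitExtension T p) := by
    simp only [orbitExtension, ofPred_forall]
    exact isClosed_iInter fun n => isClosed_eq (hp.comp (continuous_apply _))
      (T.continuous.comp (hp.comp (continuous_apply _)))
  refine ⟨orbitExtension T p, inferInstance, isCompact_iff_compactSpace.1 hcl.isCompact,
    inferInstance, inferInstance, orbitShift T p, fun y => p (y.1 0),
    hp.comp ((continuous_apply _).comp continuous_subtype_val), fun x => ?_, fun y => ?_⟩
  · choose q hq using hps
    refine ⟨⟨fun n => q ((T.toEquiv ^ n : Equiv.Perm X) x), fun n => ?_⟩, ?_⟩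
    · rw [hq, hq, add_comm, zpow_add, zpow_one]; rfl
    · simp only [hq, zpow_zero]; rfl
  · exact y.2 0

end Extension

section Factor

variable {X Y : Type*} {S : Y → Y} {T : X → X} {π : Y → X}

lemma preimage_wordSet (h : Function.Semiconj π S T) {ι : Type*} (A : ι → Set X) {n : ℕ}
    (w : Fin n → ι) : π ⁻¹' wordSet T A w = wordSet S (fun i => π ⁻¹' A i) w := by
  ext y
  simp only [mem_preimage, mem_wordSet]
  exact forall_congr' fun j => by rw [← (h.iterate_right j).eq]

/-- By surjectivity, a family of words covers upstairs exactly when it covers downstairs. -/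
lemma topEntropy_preimage (h : Function.Semiconj π S T) (hπ : Function.Surjective π) {k : ℕ}
    (U : Fin k → Set X) : topEntropy S (fun i => π ⁻¹' U i) = topEntropy T U := by
  have : ∀ n, coverNumber S (fun i => π ⁻¹' U i) n = coverNumber T U n := by
    intro n
    simp only [coverNumber, ← preimage_wordSet h, ← preimage_iUnion, preimage_eq_univ_iff,
      hπ.range_eq, univ_subset_iff]
  simp only [topEntropy, this]

/-- The preimage of a partition under a measurable map. -/
def FinPartition.comap [MeasurableSpace X] [MeasurableSpace Y] (α : FinPartition X)
    (hπ : Measurable π) : FinPartition Y where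
  size := α.size
  atom i := π ⁻¹' α.atom i
  measurableSet_atom i := hπ (α.measurableSet_atom i)
  disjoint_atom i j hij := (α.disjoint_atom i j hij).preimage π
  iUnion_atom := by rw [← preimage_iUnion, α.iUnion_atom, preimage_univ]

lemma measureEntropy_comap [MeasurableSpace X] [MeasurableSpace Y] (h : Function.Semiconj π S T)
    (hπ : Measurable π) (hT : Measurable T) (μ : Measure Y) (α : FinPartition X) :
    measureEntropy S μ (α.comap hπ) = measureEntropy T (μ.map π) α := by
  have : ∀ n, shannonEntropy S μ (α.comap hπ) n = shannonEntropy T (μ.map π) α n := by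
    intro n
    refine Finset.sum_congr rfl fun w _ => ?_
    have hm : MeasurableSet (wordSet T α.atom w) :=
      MeasurableSet.iInter fun j => (hT.iterate _) (α.measurableSet_atom _)
    rw [measureReal_def, measureReal_def, Measure.map_apply hπ hm]
    exact congrArg (fun s => Real.negMulLog (μ s).toReal) (preimage_wordSet h α.atom w).symm
  simp only [measureEntropy, this]

end Factor

/-- Ergodicity passes to factors, and each refining partition of X pulls back to one of Y with the
same entropy. -/
lemma exists_ergodic_entropy_ge {X : Type*} [TopologicalSpace X] [CompactSpace X]
    [TopologicalSpace.MetrizableSpace X] [Nonempty X] [MeasurableSpace X] [BorelSpace X]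
    (T : X ≃ₜ X) {k : ℕ} (U : Fin k → Set X) (hUo : ∀ i, IsOpen (U i))
    (hUc : (⋃ i, U i) = univ) :
    ∃ μ ∈ invariantMeasures T, Ergodic T (μ : Measure X) ∧
      ∀ α ∈ refiningPartitions U, topEntropy T U ≤ measureEntropy T (μ : Measure X) α := by
  obtain ⟨Y, _, _, _, _, S, π, hπ, hsurj, hsemi⟩ := exists_zeroDimensional_extension T
  let _ : MeasurableSpace Y := borel Y
  have : BorelSpace Y := ⟨rfl⟩
  have : Nonempty Y := hsurj.nonempty
  obtain ⟨μ, hμ, herg, hent⟩ := exists_ergodic_of_totallyDisconnected S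
    (V := fun i => π ⁻¹' U i) (fun i => (hUo i).preimage hπ)
    (by rw [← preimage_iUnion, hUc, preimage_univ])
  have hπm := hπ.measurable
  have hergX : Ergodic T ((μ : Measure Y).map π) :=
    (hπm.measurePreserving _).ergodic_of_ergodic_semiconj herg T.continuous.measurable hsemi
  refine ⟨μ.map hπm.aemeasurable, ?_, ?_, fun α hα => ?_⟩
  · simpa [invariantMeasures] using hergX.toMeasurePreserving
  · simpa using hergX
  · rw [ProbabilityMeasure.toMeasure_map, ← measureEntropy_comap hsemi hπm T.continuous.measurable,
      ← topEntropy_preimage hsemi hsurj]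
    exact hent _ fun a => (hα a).imp fun i hi => preimage_mono hi

end OpenCoverEntropy

end

theorem mainTheorem5 {X : Type*} [TopologicalSpace X] [CompactSpace X]
    [TopologicalSpace.MetrizableSpace X] [Nonempty X] [MeasurableSpace X] [BorelSpace X]
    (T : X ≃ₜ X) {k : ℕ} (U : Fin k → Set X)
    (hU_open : ∀ i, IsOpen (U i)) (hU_cover : (⋃ i, U i) = Set.univ) :
    (∀ μ ∈ OpenCoverEntropy.invariantMeasures T,
      (⨅ α ∈ OpenCoverEntropy.refiningPartitions U,
        OpenCoverEntropy.measureEntropy T (μ : MeasureTheory.Measure X) α)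
          ≤ OpenCoverEntropy.topEntropy T U) ∧
    (∃ μ₀ ∈ OpenCoverEntropy.invariantMeasures T,
      Ergodic T (μ₀ : MeasureTheory.Measure X) ∧
      ∀ α ∈ OpenCoverEntropy.refiningPartitions U,
        OpenCoverEntropy.topEntropy T U
          ≤ OpenCoverEntropy.measureEntropy T (μ₀ : MeasureTheory.Measure X) α) ∧
    OpenCoverEntropy.supInfEntropy T U = OpenCoverEntropy.infSupEntropy T U ∧
    OpenCoverEntropy.infSupEntropy T U = OpenCoverEntropy.topEntropy T U := by
  have : SecondCountableTopology X := by
    let _ := TopologicalSpace.metrizableSpaceMetric X; infer_instance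
  obtain ⟨μ₀, hμ₀, herg, hent⟩ :=
    OpenCoverEntropy.exists_ergodic_entropy_ge T U hU_open hU_cover
  have h1 : OpenCoverEntropy.topEntropy T U ≤ OpenCoverEntropy.supInfEntropy T U :=
    le_iSup₂_of_le μ₀ hμ₀ (le_iInf₂ hent)
  have h2 : OpenCoverEntropy.supInfEntropy T U ≤ OpenCoverEntropy.infSupEntropy T U :=
    iSup₂_le fun μ hμ => iInf₂_mono fun α _ => le_iSup₂_of_le μ hμ le_rfl
  have h3 := OpenCoverEntropy.infSupEntropy_le_topEntropy T U hU_open hU_cover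
  exact ⟨fun μ _ => OpenCoverEntropy.iInf_measureEntropy_le_topEntropy T U hU_open hU_cover μ,
    ⟨μ₀, hμ₀, herg, hent⟩, le_antisymm h2 (h3.trans h1), le_antisymm h3 (h1.trans h2)⟩
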